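/- Let $\mathcal X,\mathcal Z$ be finite alphabets, let $P_{Z|X}$ be a discrete memoryless channel (the wiretap channel), $P(\mathbf z|\mathbf x)=\prod_{i=1}^n P_{Z|X}(z_i|x_i)$, and let $P_X$ be an empirical distribution on $\mathcal X$, i.e. one for which the type class $\mathcal T_n(P_X)=\{\mathbf x\in\mathcal X^n:\text{ the empirical distribution of }\mathbf x\text{ is }P_X\}$ is non-empty for some $n\ge1$. Let $0\le R_2\le R_1$, and let $M=M(n)\ge1$ and $M_2=M_2(n)\ge1$ be integers with $\frac1n\ln M\to R_1-R_2$ and $\frac1n\ln M_2\to R_2$ (that is, $M$ and $M_2$ are $e^{n(R_1-R_2)}$ and $e^{nR_2}$ up to sub-exponential factors such as those due to rounding). Draw the $M_1=MM_2$ codewords $\mathbf x_{w,b}$, $0\le w<M$, $0\le b<M_2$, independently and uniformly from $\mathcal T_n(P_X)$. A message $w$ is sent by transmitting $\mathbf x_{w,b}$ with $b$ uniform on $\{0,\dots,M_2-1\}$. The wiretapper, who knows the codebook and observes $\mathbf z$, uses an optimal decoder $\hat w(\mathbf z)\in\arg\max_w P(\mathbf z|\mathcal C_w)$, where $P(\mathbf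 z|\mathcal C_w)=\frac1{M_2}\sum_b P(\mathbf z|\mathbf x_{w,b})$, with ties broken arbitrarily. Let $P_c=\frac1M\sum_{w}\Pr\{\hat w(\mathbf Z)=w\mid W=w\}$ be the probability of correct decoding, and $\overline{P_c}$ its average over the random codebook. Then the limit $$E(R_1,R_2)=\lim_{n\to\infty}\Big[-\frac{\ln\overline{P_c}}{n}\Big],$$ taken over those $n$ for which $\mathcal T_n(P_X)\neq\emptyset$, exists and $$E(R_1,R_2)=\min\{E_1(R_1,R_2),E_2(R_1,R_2),E_3(R_1)\},$$ where $$E_1(R_1,R_2)=R_1-R_2+\min_{Q_{Z|X}}\{D(Q_{Z|X}\|P_{Z|X}|P_X):\ I_Q(X;Z)\le R_2\},$$ $$E_2(R_1,R_2)=R_1+\min_{Q_{Z|X}}\{D(Q_{Z|X}\|P_{Z|X}|P_X)-I_Q(X;Z):\ R_2\le I_Q(X;Z)\le R_1\},$$ $$E_3(R_1)=\min_{Q_{Z|X}}\{D(Q_{Z|X}\|P_{Z|X}|P_X):\ I_Q(X;Z)\ge R_1\}.$$ Here $Q_{Z|X}$ ranges over all channels from $\mathcal X$ to $\mathcal Z$,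 $I_Q(X;Z)$ is the mutual information (natural logarithms) of $P_X\times Q_{Z|X}$, $D(Q_{Z|X}\|P_{Z|X}|P_X)=\sum_xP_X(x)\sum_zQ_{Z|X}(z|x)\ln\frac{Q_{Z|X}(z|x)}{P_{Z|X}(z|x)}$ with values in $[0,\infty]$ and the usual conventions for zeros, and a minimum over an empty set is $+\infty$. Moreover, $$E(R_1,R_2)=\min_{\lambda_2\in[0,1]}\ \max_{\lambda_1\in[0,1]}\ \min_{Q_{Z|X}}\big\{D(Q_{Z|X}\|P_{Z|X}|P_X)+(\lambda_1+\lambda_2-1)I_Q(X;Z)+(1-\lambda_1)R_1-\lambda_2R_2\big\}.$$ All the minima (over non-empty sets) and the maximum above are attained. -/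

import Mathlib

open Filter Topology Set

noncomputable section

namespace Wiretap

variable {X Z : Type*} [Fintype X] [Fintype Z]

/-! ### Types and memoryless channels -/

open Classical in
/-- The type class of `PX` at block length `n`: all `x ∈ Xⁿ` whose empirical distribution
is `PX`. It is empty unless `n * PX a` is an integer for every letter `a`. -/
def typeClass (n : ℕ) (PX : X → ℝ) : Finset (Fin n → X) :=
  Finset.univ.filter fun x =>
    ∀ a : X, ((Finset.univ.filter fun i : Fin n => x i = a).card : ℝ) / (n : ℝ) = PX a

/-- All channels from `X` to `Z`, that is, row-stochastic matrices `Q x z = Q(z|x)`. -/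
def channels (X Z : Type*) [Fintype Z] : Set (X → Z → ℝ) :=
  {Q | ∀ x, Q x ∈ stdSimplex ℝ Z}

/-- `P(z|x) = ∏ᵢ P(zᵢ|xᵢ)`, the transition probability of the memoryless channel `P`. -/
def seqProb {n : ℕ} (P : X → Z → ℝ) (x : Fin n → X) (z : Fin n → Z) : ℝ :=
  ∏ i, P (x i) (z i)

/-! ### The code, the decoder and the probability of correct decoding

A codebook is divided into `M` sub-codes of `M₂` codewords each; `C w b` is the codeword sent for
the message `w` when the local randomness of the encoder takes the value `b`. -/

/-- `P(z|C_w)`: the probability that the channel output is `z` if a codeword of the sub-code `c`,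
chosen uniformly at random, is transmitted. -/
def subcodeProb {n M₂ : ℕ} (P : X → Z → ℝ) (c : Fin M₂ → Fin n → X) (z : Fin n → Z) : ℝ :=
  (1 / (M₂ : ℝ)) * ∑ b, seqProb P (c b) z

/-- `dec` is an optimal decoder for the codebook `C`: it maximizes `P(z|C_w)` over `w`
(ties may be broken in any way). -/
def IsOptimalDecoder {n M M₂ : ℕ} (P : X → Z → ℝ) (C : Fin M → Fin M₂ → Fin n → X)
    (dec : (Fin n → Z) → Fin M) : Prop :=
  ∀ z w, subcodeProb P (C w) z ≤ subcodeProb P (C (dec z)) z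

/-- `P_c = (1/M) ∑_w Pr{dec(Z) = w | W = w}`. -/
def correctProb {n M M₂ : ℕ} (P : X → Z → ℝ) (C : Fin M → Fin M₂ → Fin n → X)
    (dec : (Fin n → Z) → Fin M) : ℝ :=
  (1 / (M : ℝ)) * ∑ w, ∑ z, if dec z = w then subcodeProb P (C w) z else 0

/-- The codebooks all of whose codewords belong to the type class of `PX`. -/
def codebooks (n M M₂ : ℕ) (PX : X → ℝ) : Finset (Fin M → Fin M₂ → Fin n → X) :=
  Fintype.piFinset fun _ => Fintype.piFinset fun _ => typeClass n PX

/-- The ensemble average of `P_c`. The `M * M₂` codewords are drawn independently and uniformly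
from the type class, which means that the codebook is uniform on `codebooks n M M₂ PX`. The
decoder may depend on the codebook. -/
def avgCorrectProb {n M M₂ : ℕ} (P : X → Z → ℝ) (PX : X → ℝ)
    (dec : (Fin M → Fin M₂ → Fin n → X) → (Fin n → Z) → Fin M) : ℝ :=
  (∑ C ∈ codebooks n M M₂ PX, correctProb P C (dec C)) / ((codebooks n M M₂ PX).card : ℝ)

/-! ### Information measures (natural logarithms) -/

/-- The marginal of `Z` under the joint distribution `PX × Q`. -/
def outputDist (PX : X → ℝ) (Q : X → Z → ℝ) (z : Z) : ℝ :=
  ∑ x, PX x * Q x z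

/-- The mutual information `I_Q(X;Z)` of the joint distribution `PX × Q`. -/
def mutualInfo (PX : X → ℝ) (Q : X → Z → ℝ) : ℝ :=
  ∑ x, ∑ z, PX x * Q x z * Real.log (Q x z / outputDist PX Q z)

open Classical in
/-- The weighted divergence `D(Q‖P|PX)`, with the usual conventions: a term with weight zero or
with `Q(z|x) = 0` vanishes, and the value is `+∞` if `Q(z|x) > 0 = P(z|x)` for some `z` and
some `x` of positive weight. -/
def condDiv (PX : X → ℝ) (Q P : X → Z → ℝ) : EReal :=
  if ∃ x z, 0 < PX x ∧ 0 < Q x z ∧ P x z = 0 then ⊤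
  else ((∑ x, PX x * ∑ z, Q x z * Real.log (Q x z / P x z) : ℝ) : EReal)

/-! ### The exponents

A minimum over an empty set is `+∞`. -/

/-- The channels with `I_Q(X;Z) ≤ R₂`. -/
def feasible₁ (X Z : Type*) [Fintype X] [Fintype Z] (PX : X → ℝ) (R₂ : ℝ) : Set (X → Z → ℝ) :=
  {Q ∈ channels X Z | mutualInfo PX Q ≤ R₂}

/-- The channels with `R₂ ≤ I_Q(X;Z) ≤ R₁`. -/
def feasible₂ (X Z : Type*) [Fintype X] [Fintype Z] (PX : X → ℝ) (R₁ R₂ : ℝ) :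
    Set (X → Z → ℝ) :=
  {Q ∈ channels X Z | R₂ ≤ mutualInfo PX Q ∧ mutualInfo PX Q ≤ R₁}

/-- The channels with `I_Q(X;Z) ≥ R₁`. -/
def feasible₃ (X Z : Type*) [Fintype X] [Fintype Z] (PX : X → ℝ) (R₁ : ℝ) : Set (X → Z → ℝ) :=
  {Q ∈ channels X Z | R₁ ≤ mutualInfo PX Q}

/-- `E₁(R₁,R₂) = R₁ - R₂ + min {D(Q‖P|PX) : I_Q(X;Z) ≤ R₂}`. -/
def exponent₁ (PX : X → ℝ) (P : X → Z → ℝ) (R₁ R₂ : ℝ) : EReal :=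
  ((R₁ - R₂ : ℝ) : EReal) + ⨅ Q ∈ feasible₁ X Z PX R₂, condDiv PX Q P

/-- `E₂(R₁,R₂) = R₁ + min {D(Q‖P|PX) - I_Q(X;Z) : R₂ ≤ I_Q(X;Z) ≤ R₁}`. -/
def exponent₂ (PX : X → ℝ) (P : X → Z → ℝ) (R₁ R₂ : ℝ) : EReal :=
  (R₁ : EReal) + ⨅ Q ∈ feasible₂ X Z PX R₁ R₂, (condDiv PX Q P - (mutualInfo PX Q : EReal))

/-- `E₃(R₁) = min {D(Q‖P|PX) : I_Q(X;Z) ≥ R₁}`. -/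
def exponent₃ (PX : X → ℝ) (P : X → Z → ℝ) (R₁ : ℝ) : EReal :=
  ⨅ Q ∈ feasible₃ X Z PX R₁, condDiv PX Q P

/-- `D(Q‖P|PX) + (t₁ + t₂ - 1) I_Q(X;Z) + (1 - t₁) R₁ - t₂ R₂`, the objective of the second
representation, with `t₁`, `t₂` in the place of `λ₁`, `λ₂`. -/
def lagrangian (PX : X → ℝ) (P : X → Z → ℝ) (R₁ R₂ t₁ t₂ : ℝ) (Q : X → Z → ℝ) : EReal :=
  condDiv PX Q P +
    (((t₁ + t₂ - 1) * mutualInfo PX Q + (1 - t₁) * R₁ - t₂ * R₂ : ℝ) : EReal)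

/-- The minimum of the objective over all channels. -/
def innerMin (PX : X → ℝ) (P : X → Z → ℝ) (R₁ R₂ t₁ t₂ : ℝ) : EReal :=
  ⨅ Q ∈ channels X Z, lagrangian PX P R₁ R₂ t₁ t₂ Q

/-- The maximum of `innerMin` over `t₁ ∈ [0,1]`. -/
def middleMax (PX : X → ℝ) (P : X → Z → ℝ) (R₁ R₂ t₂ : ℝ) : EReal :=
  ⨆ t₁ ∈ Icc (0 : ℝ) 1, innerMin PX P R₁ R₂ t₁ t₂

end Wiretap

end

set_option linter.unusedSectionVars false

noncomputable section

namespace Wiretap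

variable {X Z : Type*} [Fintype X] [Fintype Z]

/-! ### Divergence and mutual information as real functions of the channel -/

/-! As the decoder is optimal, `P_c` is `1/M` times the sum over `z` of the maximum over `w` of
`P(z|C_w)`. Group the codewords of each sub-code by their joint type with `z`. For a joint type with
conditional distribution `Q`, write `D` for the divergence and `I` for the mutual information. The
number of codewords of a sub-code that have this joint type with `z` is binomial with `M₂` trials
and success probability about `exp(-nI)`. Up to subexponential factors, the expected maximum of `M`
such numbers is `exp(n(R₂ - I))` if `I ≤ R₂` (each is near its mean), `1` if `R₂ ≤ I ≤ R₁`, and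
`exp(n(R₁ - I))` if `I ≥ R₁` (the probability that some codeword hits at all). The pairs `(x, z)` of
this type have probability `p = P(z|x)`, and `p` times the number of relevant `z` is about `exp(-n(D
- I))`. After division by `M M₂` the joint type therefore contributes about `exp(-n(D + max {0, min
{R₁ - I, R₁ - R₂}}))`. There are polynomially many joint types, so the exponent is the minimum over
`Q` of `rateObjective`, and sorting `Q` by the value of `I` gives `E₁`, `E₂`, `E₃`
(`min_exponent_eq`).

No concentration inequality is needed. From above, the hits of the selected row are bounded by the
sum over all rows (`expect_hits_selected_le_mul`) or through an exponential moment
(`expect_hits_selected_le_log`). From below, a fixed row (`expect_hits`) or the event that some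
codeword hits (`le_expect_exists_mem`) suffices. The passage to single letters rests on type class
sizes (`abs_log_card_seqsWithCounts_sub_le`) and on rounding the optimal channel to joint types
(`exists_tendsto_channelOfCounts`).

For the second representation, `max {0, min {R₁ - I, R₁ - R₂}}` is the minimum over `t₂` of the
maximum over `t₁` of `(1 - t₁)(R₁ - I) + t₂(I - R₂)`. For fixed `t₂`, Sion's theorem exchanges the
minimum over `Q` with the maximum over `t₁`: the objective is affine in `t₁`, and convex in `Q`
since both `I` and `D - I` are convex (`exists_saddlePoint`). -/

/-- The channels `Q` with `Q(z|x) = 0` wherever `P(z|x) = 0` and `x` has positive weight. -/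
def dominated (PX : X → ℝ) (P : X → Z → ℝ) : Set (X → Z → ℝ) :=
  {Q ∈ channels X Z | ∀ x z, 0 < PX x → P x z = 0 → Q x z = 0}

/-- The conditional divergence, written so that it is continuous in `Q`. -/
def realDiv (PX : X → ℝ) (P Q : X → Z → ℝ) : ℝ :=
  ∑ x, PX x * ∑ z, (Q x z * Real.log (Q x z) - Q x z * Real.log (P x z))

/-- The mutual information, written so that it is continuous in `Q`. -/
def realInfo (PX : X → ℝ) (Q : X → Z → ℝ) : ℝ :=
  ∑ x, PX x * (∑ z, Q x z * Real.log (Q x z))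
    - ∑ z, outputDist PX Q z * Real.log (outputDist PX Q z)

lemma outputDist_nonneg {PX : X → ℝ} (h : ∀ x, 0 ≤ PX x) {Q : X → Z → ℝ}
    (hQ : Q ∈ channels X Z) (z : Z) : 0 ≤ outputDist PX Q z :=
  Finset.sum_nonneg fun x _ => mul_nonneg (h x) ((hQ x).1 z)

lemma eq_zero_of_outputDist_eq_zero {PX : X → ℝ} (h : ∀ x, 0 ≤ PX x) {Q : X → Z → ℝ}
    (hQ : Q ∈ channels X Z) {z : Z} (hz : outputDist PX Q z = 0) (x : X) :
    PX x * Q x z = 0 :=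
  (Finset.sum_eq_zero_iff_of_nonneg fun x _ => mul_nonneg (h x) ((hQ x).1 z)).1 hz x
    (Finset.mem_univ x)

/-- The logarithm of the quotient may be split because an output letter of probability zero has `PX
x * Q x z = 0` for every `x`. The split form involves only `t log t`, which is continuous at `0`. -/
lemma mutualInfo_eq_realInfo {PX : X → ℝ} (h : ∀ x, 0 ≤ PX x) {Q : X → Z → ℝ}
    (hQ : Q ∈ channels X Z) : mutualInfo PX Q = realInfo PX Q := by
  have h1 : ∀ x z, PX x * Q x z * Real.log (Q x z / outputDist PX Q z) =
      PX x * (Q x z * Real.log (Q x z)) - PX x * Q x z * Real.log (outputDist PX Q z) := by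
    intro x z
    by_cases h0 : outputDist PX Q z = 0
    · have h2 := eq_zero_of_outputDist_eq_zero h hQ h0 x
      rw [← mul_assoc, h2]; ring
    · by_cases h2 : Q x z = 0
      · simp [h2]
      · rw [Real.log_div h2 h0]; ring
  unfold mutualInfo realInfo
  simp_rw [h1, Finset.sum_sub_distrib, Finset.mul_sum]
  congr 1
  rw [Finset.sum_comm]
  refine Finset.sum_congr rfl fun z _ => ?_
  rw [← Finset.sum_mul]; rfl

lemma condDiv_of_dominated {PX : X → ℝ} (h : ∀ x, 0 ≤ PX x) {P Q : X → Z → ℝ}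
    (hQ : Q ∈ dominated PX P) : condDiv PX Q P = (realDiv PX P Q : EReal) := by
  unfold condDiv realDiv
  rw [if_neg]
  · congr 1
    refine Finset.sum_congr rfl fun x _ => ?_
    rcases (h x).eq_or_lt with h0 | h0
    · simp [← h0]
    · congr 1
      refine Finset.sum_congr rfl fun z _ => ?_
      by_cases h1 : Q x z = 0
      · simp [h1]
      · rw [Real.log_div h1 fun h2 => h1 (hQ.2 x z h0 h2)]; ring
  · rintro ⟨x, z, h0, h1, h2⟩
    exact h1.ne' (hQ.2 x z h0 h2)

lemma condDiv_of_not_dominated {PX : X → ℝ} {P Q : X → Z → ℝ} (hQ : Q ∈ channels X Z)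
    (hQ' : Q ∉ dominated PX P) : condDiv PX Q P = ⊤ := by
  unfold condDiv
  rw [if_pos]
  by_contra hc
  push Not at hc
  refine hQ' ⟨hQ, fun x z h0 h1 => ?_⟩
  by_contra h2
  exact hc x z h0 (lt_of_le_of_ne ((hQ x).1 z) (Ne.symm h2)) h1

lemma continuous_realDiv (PX : X → ℝ) (P : X → Z → ℝ) : Continuous (realDiv PX P) := by
  unfold realDiv
  have := Real.continuous_mul_log
  refine continuous_finsetSum _ fun x _ => continuous_const.mul <|
    continuous_finsetSum _ fun z _ => ?_
  have h1 : Continuous fun Q : X → Z → ℝ => Q x z := by fun_prop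
  exact (this.comp h1).sub (h1.mul continuous_const)

lemma continuous_realInfo (PX : X → ℝ) : Continuous (realInfo (Z := Z) PX) := by
  unfold realInfo
  have := Real.continuous_mul_log
  refine Continuous.sub (continuous_finsetSum _ fun x _ => continuous_const.mul <|
    continuous_finsetSum _ fun z _ => ?_) (continuous_finsetSum _ fun z _ => ?_)
  · have h1 : Continuous fun Q : X → Z → ℝ => Q x z := by fun_prop
    exact this.comp h1
  · have h1 : Continuous fun Q : X → Z → ℝ => outputDist PX Q z := by
      unfold outputDist; fun_prop
    exact this.comp h1

lemma isCompact_channels : IsCompact (channels X Z) := by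
  have : channels X Z = Set.univ.pi fun _ : X => stdSimplex ℝ Z := by
    ext Q; simp [channels]
  rw [this]
  exact isCompact_univ_pi fun _ => isCompact_stdSimplex ℝ Z

lemma convex_channels : Convex ℝ (channels X Z) := by
  have : channels X Z = Set.univ.pi fun _ : X => stdSimplex ℝ Z := by
    ext Q; simp [channels]
  rw [this]
  exact convex_pi fun _ _ => convex_stdSimplex ℝ Z

lemma isCompact_dominated (PX : X → ℝ) (P : X → Z → ℝ) : IsCompact (dominated PX P) := by
  refine isCompact_channels.inter_right (t := {Q | ∀ x z, 0 < PX x → P x z = 0 → Q x z = 0}) ?_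
  simp only [Set.ofPred_forall]
  refine isClosed_iInter fun x => isClosed_iInter fun z => isClosed_iInter fun _ =>
    isClosed_iInter fun _ => ?_
  exact isClosed_eq (by fun_prop) continuous_const

lemma convex_dominated (PX : X → ℝ) (P : X → Z → ℝ) : Convex ℝ (dominated PX P) := by
  intro Q hQ Q' hQ' a b ha hb hab
  refine ⟨convex_channels hQ.1 hQ'.1 ha hb hab, fun x z h0 h1 => ?_⟩
  simp [hQ.2 x z h0 h1, hQ'.2 x z h0 h1]

lemma mem_dominated_self {PX : X → ℝ} {P : X → Z → ℝ} (hP : P ∈ channels X Z) :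
    P ∈ dominated PX P := ⟨hP, fun _ _ _ h => h⟩

lemma convexOn_realDiv {PX : X → ℝ} (h : ∀ x, 0 ≤ PX x) (P : X → Z → ℝ) :
    ConvexOn ℝ (channels X Z) (realDiv PX P) := by
  refine ⟨convex_channels, fun Q hQ Q' hQ' a b ha hb hab => ?_⟩
  simp only [realDiv, smul_eq_mul, Finset.mul_sum, ← Finset.sum_add_distrib]
  refine Finset.sum_le_sum fun x _ => Finset.sum_le_sum fun z _ => ?_
  have h1 := Real.convexOn_mul_log.2 ((hQ x).1 z) ((hQ' x).1 z) ha hb hab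
  simp only [smul_eq_mul, Pi.add_apply, Pi.smul_apply] at h1 ⊢
  have h2 := mul_le_mul_of_nonneg_left h1 (h x)
  linarith

/-- The affine lower bounds of `u log (u / v)`. -/
lemma mul_log_add_sub_le {u v c : ℝ} (hu : 0 ≤ u) (hv : 0 ≤ v) (huv : v = 0 → u = 0)
    (hc : 0 < c) : u * Real.log c + u - c * v ≤ u * Real.log (u / v) := by
  rcases hu.eq_or_lt with h0 | h0
  · simp only [← h0, zero_mul, zero_add, zero_sub]
    nlinarith [mul_nonneg hc.le hv]
  · have hv' : 0 < v := lt_of_le_of_ne hv fun h => h0.ne' (huv h.symm)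
    have h1 := Real.log_le_sub_one_of_pos (x := c * v / u) (by positivity)
    rw [Real.log_div (by positivity) (by positivity), Real.log_mul hc.ne' hv'.ne'] at h1
    rw [Real.log_div h0.ne' hv'.ne']
    have h2 := mul_le_mul_of_nonneg_left h1 h0.le
    have h3 : u * (c * v / u - 1) = c * v - u := by field_simp
    rw [h3] at h2
    linarith

/-- The log-sum inequality. With the common value `c = (u + u') / (v + v')` in the two affine
bounds, their non-logarithmic terms add up to zero. -/
lemma add_mul_log_div_add_le {u v u' v' : ℝ} (hu : 0 ≤ u) (hv : 0 ≤ v) (huv : v = 0 → u = 0)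
    (hu' : 0 ≤ u') (hv' : 0 ≤ v') (huv' : v' = 0 → u' = 0) :
    (u + u') * Real.log ((u + u') / (v + v')) ≤
      u * Real.log (u / v) + u' * Real.log (u' / v') := by
  rcases (add_nonneg hu hu').eq_or_lt with h0 | h0
  · have h1 : u = 0 := by linarith
    have h2 : u' = 0 := by linarith
    simp [h1, h2]
  · have hv0 : 0 < v + v' := by
      refine lt_of_le_of_ne (add_nonneg hv hv') fun h => ?_
      have h1 := huv (by linarith)
      have h2 := huv' (by linarith)
      linarith
    have h1 := mul_log_add_sub_le hu hv huv (div_pos h0 hv0)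
    have h2 := mul_log_add_sub_le hu' hv' huv' (div_pos h0 hv0)
    have h3 : (u + u') / (v + v') * v + (u + u') / (v + v') * v' = u + u' := by
      field_simp
    linarith

/-- The output distribution is linear in `Q`, so the log-sum inequality applies to each pair `(x,
z)` separately. -/
lemma convexOn_mutualInfo {PX : X → ℝ} (h : ∀ x, 0 ≤ PX x) :
    ConvexOn ℝ (channels X Z) (mutualInfo PX) := by
  refine ⟨convex_channels, fun Q hQ Q' hQ' a b ha hb hab => ?_⟩
  simp only [mutualInfo, smul_eq_mul, Finset.mul_sum, ← Finset.sum_add_distrib]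
  refine Finset.sum_le_sum fun x _ => Finset.sum_le_sum fun z _ => ?_
  have h1 : outputDist PX (a • Q + b • Q') z =
      a * outputDist PX Q z + b * outputDist PX Q' z := by
    simp only [outputDist, Finset.mul_sum, ← Finset.sum_add_distrib]
    refine Finset.sum_congr rfl fun x _ => ?_
    simp only [Pi.add_apply, Pi.smul_apply, smul_eq_mul]; ring
  rw [h1]
  simp only [Pi.add_apply, Pi.smul_apply, smul_eq_mul]
  rcases (h x).eq_or_lt with h0 | h0
  · simp [← h0]
  -- The log-sum inequality requires each numerator to vanish with its denominator. This uses `0 <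
  -- PX x`, which is why letters of weight zero are treated first.
  have key : ∀ (c : ℝ) (Q : X → Z → ℝ), 0 ≤ c → Q ∈ channels X Z →
      c * outputDist PX Q z = 0 → c * Q x z = 0 := by
    intro c Q hc hQ h2
    rcases mul_eq_zero.1 h2 with h3 | h3
    · simp [h3]
    · rcases mul_eq_zero.1 (eq_zero_of_outputDist_eq_zero h hQ h3 x) with h4 | h4
      · exact absurd h4 h0.ne'
      · simp [h4]
  have h2 := add_mul_log_div_add_le (mul_nonneg ha ((hQ x).1 z))
    (mul_nonneg ha (outputDist_nonneg h hQ z)) (key a Q ha hQ) (mul_nonneg hb ((hQ' x).1 z))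
    (mul_nonneg hb (outputDist_nonneg h hQ' z)) (key b Q' hb hQ')
  have cancel : ∀ c s t : ℝ, c * s * Real.log (c * s / (c * t)) = c * s * Real.log (s / t) := by
    intro c s t
    by_cases hc : c = 0
    · simp [hc]
    · rw [mul_div_mul_left _ _ hc]
  rw [cancel, cancel] at h2
  have h3 := mul_le_mul_of_nonneg_left h2 (h x)
  linarith

/-- The terms `Q log Q` cancel. What remains is minus the output entropy, convex because the output
distribution is linear in `Q`, and a term linear in `Q`. -/
lemma convexOn_realDiv_sub_realInfo {PX : X → ℝ} (h : ∀ x, 0 ≤ PX x) (P : X → Z → ℝ) :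
    ConvexOn ℝ (channels X Z) fun Q => realDiv PX P Q - realInfo PX Q := by
  have h1 : (fun Q : X → Z → ℝ => realDiv PX P Q - realInfo PX Q) = fun Q =>
      ∑ z, (outputDist PX Q z * Real.log (outputDist PX Q z)
        - ∑ x, PX x * (Q x z * Real.log (P x z))) := by
    funext Q
    simp only [realDiv, realInfo, Finset.sum_sub_distrib, mul_sub]
    rw [Finset.sum_comm (s := (Finset.univ : Finset Z))]
    simp only [Finset.mul_sum]
    ring
  rw [h1]
  refine ⟨convex_channels, fun Q hQ Q' hQ' a b ha hb hab => ?_⟩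
  simp only [smul_eq_mul, Finset.mul_sum, ← Finset.sum_add_distrib]
  refine Finset.sum_le_sum fun z _ => ?_
  have h1 : outputDist PX (a • Q + b • Q') z =
      a * outputDist PX Q z + b * outputDist PX Q' z := by
    simp only [outputDist, Finset.mul_sum, ← Finset.sum_add_distrib]
    refine Finset.sum_congr rfl fun x _ => ?_
    simp only [Pi.add_apply, Pi.smul_apply, smul_eq_mul]; ring
  have h2 := Real.convexOn_mul_log.2 (outputDist_nonneg h hQ z) (outputDist_nonneg h hQ' z)
    ha hb hab
  simp only [smul_eq_mul] at h2
  rw [h1]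
  have h3 : ∑ x, PX x * ((a • Q + b • Q') x z * Real.log (P x z)) =
      a * ∑ x, PX x * (Q x z * Real.log (P x z)) +
        b * ∑ x, PX x * (Q' x z * Real.log (P x z)) := by
    simp only [Finset.mul_sum, ← Finset.sum_add_distrib]
    refine Finset.sum_congr rfl fun x _ => ?_
    simp only [Pi.add_apply, Pi.smul_apply, smul_eq_mul]; ring
  rw [h3]
  linarith

/-- For `-1 ≤ c ≤ 0` the function is `(1 + c) D + (-c) (D - I)`, a nonnegative combination of convex
functions. The coefficient `t₁ + t₂ - 1` of the Lagrangian stays in the range `-1 ≤ c`. -/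
lemma convexOn_realDiv_add {PX : X → ℝ} (h : ∀ x, 0 ≤ PX x) (P : X → Z → ℝ) {c : ℝ}
    (hc : -1 ≤ c) :
    ConvexOn ℝ (channels X Z) fun Q => realDiv PX P Q + c * realInfo PX Q := by
  rcases le_total 0 c with h0 | h0
  · have h1 : ConvexOn ℝ (channels X Z) (realInfo (Z := Z) PX) :=
      (convexOn_mutualInfo h).congr fun Q hQ => mutualInfo_eq_realInfo h hQ
    exact (convexOn_realDiv h P).add (h1.smul h0)
  · have h1 := ((convexOn_realDiv h P).smul (by linarith : 0 ≤ 1 + c)).add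
      ((convexOn_realDiv_sub_realInfo h P).smul (by linarith : 0 ≤ -c))
    refine h1.congr fun Q _ => ?_
    simp only [Pi.add_apply, smul_eq_mul]; ring

/-! ### Minima of extended real functions that are infinite off the dominated channels -/

/-- Compactness gives a minimizer if `S` meets the dominated channels. Otherwise `g` is constantly
`⊤` on `S` and any point will do. -/
lemma exists_isMinOn_of_eq_top {PX : X → ℝ} {P : X → Z → ℝ} {S : Set (X → Z → ℝ)}
    {f : (X → Z → ℝ) → ℝ} {g : (X → Z → ℝ) → EReal} (hne : S.Nonempty)
    (hS : IsCompact (S ∩ dominated PX P)) (hf : Continuous f)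
    (hfg : ∀ Q ∈ S ∩ dominated PX P, g Q = f Q) (hg : ∀ Q ∈ S, Q ∉ dominated PX P → g Q = ⊤) :
    ∃ Q ∈ S, IsMinOn g S Q := by
  by_cases h : (S ∩ dominated PX P).Nonempty
  · obtain ⟨Q, hQ, hmin⟩ := hS.exists_isMinOn h hf.continuousOn
    refine ⟨Q, hQ.1, fun Q' hQ' => ?_⟩
    by_cases h' : Q' ∈ dominated PX P
    · simp only [mem_ofPred_eq, hfg Q hQ, hfg Q' ⟨hQ', h'⟩]
      exact EReal.coe_le_coe_iff.2 (hmin ⟨hQ', h'⟩)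
    · simp [hg Q' hQ' h']
  · obtain ⟨Q, hQ⟩ := hne
    refine ⟨Q, hQ, fun Q' hQ' => ?_⟩
    have h' : Q' ∉ dominated PX P := fun h' => h ⟨Q', hQ', h'⟩
    simp [hg Q' hQ' h']

lemma isCompact_sep_inter_dominated {PX : X → ℝ} (h : ∀ x, 0 ≤ PX x) (P : X → Z → ℝ)
    {T : Set ℝ} (hT : IsClosed T) :
    IsCompact ({Q ∈ channels X Z | mutualInfo PX Q ∈ T} ∩ dominated PX P) := by
  have h1 : {Q ∈ channels X Z | mutualInfo PX Q ∈ T} ∩ dominated PX P =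
      dominated PX P ∩ realInfo PX ⁻¹' T := by
    ext Q
    simp only [mem_inter_iff, mem_ofPred_eq, mem_preimage]
    constructor
    · rintro ⟨⟨h1, h2⟩, h3⟩
      exact ⟨h3, by rwa [← mutualInfo_eq_realInfo h h1]⟩
    · rintro ⟨h1, h2⟩
      exact ⟨⟨h1.1, by rwa [mutualInfo_eq_realInfo h h1.1]⟩, h1⟩
  rw [h1]
  exact (isCompact_dominated PX P).inter_right (hT.preimage (continuous_realInfo PX))

/-- This serves `E₁`, `E₂`, `E₃` at once, with `c = 0, 1, 0` and `T` a lower ray, an interval and an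
upper ray. -/
lemma exists_isMinOn_condDiv_sub {PX : X → ℝ} (h : ∀ x, 0 ≤ PX x) (P : X → Z → ℝ)
    {T : Set ℝ} (hT : IsClosed T) (c : ℝ)
    (hne : {Q ∈ channels X Z | mutualInfo PX Q ∈ T}.Nonempty) :
    ∃ Q ∈ {Q ∈ channels X Z | mutualInfo PX Q ∈ T},
      IsMinOn (fun Q => condDiv PX Q P - ((c * mutualInfo PX Q : ℝ) : EReal))
        {Q ∈ channels X Z | mutualInfo PX Q ∈ T} Q := by
  refine exists_isMinOn_of_eq_top (PX := PX) (P := P)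
    (f := fun Q => realDiv PX P Q - c * realInfo PX Q) hne
    (isCompact_sep_inter_dominated h P hT)
    ((continuous_realDiv PX P).sub ((continuous_realInfo PX).const_mul c)) ?_ ?_
  · intro Q hQ
    rw [condDiv_of_dominated h hQ.2, mutualInfo_eq_realInfo h hQ.1.1]
    exact (EReal.coe_sub _ _).symm
  · intro Q hQ hQ'
    rw [condDiv_of_not_dominated hQ.1 hQ', EReal.top_sub_coe]

/-! ### The exponent as a single minimum -/

/-- `D(Q‖P|PX) + max {0, min {R₁ - I_Q(X;Z), S}}`; for `S = R₁ - R₂` its minimum is the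
exponent. -/
def rateObjective (PX : X → ℝ) (P : X → Z → ℝ) (R₁ S : ℝ) (Q : X → Z → ℝ) : ℝ :=
  realDiv PX P Q + max 0 (min (R₁ - realInfo PX Q) S)

lemma continuous_rateObjective (PX : X → ℝ) (P : X → Z → ℝ) (R₁ S : ℝ) :
    Continuous (rateObjective PX P R₁ S) := by
  have h1 := continuous_realDiv PX P
  have h2 := continuous_realInfo (Z := Z) PX
  unfold rateObjective
  fun_prop

lemma exists_isMinOn_rateObjective {PX : X → ℝ} {P : X → Z → ℝ} (hP : P ∈ channels X Z)
    (R₁ S : ℝ) :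
    ∃ Q ∈ dominated PX P, IsMinOn (rateObjective PX P R₁ S) (dominated PX P) Q :=
  (isCompact_dominated PX P).exists_isMinOn ⟨P, mem_dominated_self hP⟩
    (continuous_rateObjective PX P R₁ S).continuousOn

lemma coe_le_coe_add_biInf {S : Set (X → Z → ℝ)} {g : (X → Z → ℝ) → EReal} {E c : ℝ}
    (h : ∀ Q ∈ S, ((E - c : ℝ) : EReal) ≤ g Q) :
    (E : EReal) ≤ (c : EReal) + ⨅ Q ∈ S, g Q := by
  have h1 : (E : EReal) = (c : EReal) + ((E - c : ℝ) : EReal) := by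
    rw [← EReal.coe_add]; congr 1; ring
  rw [h1]
  gcongr
  exact le_iInf₂ h

/-- The bracket `max 0 (min (R₁ - I) (R₁ - R₂))` equals `R₁ - R₂`, `R₁ - I` and `0` in the ranges `I
≤ R₂`, `R₂ ≤ I ≤ R₁` and `R₁ ≤ I`. The three exponents thus split one minimum by the value of `I`;
channels that are not dominated only add the value `⊤`. -/
lemma min_exponent_eq {PX : X → ℝ} (h : ∀ x, 0 ≤ PX x) {P : X → Z → ℝ}
    {R₁ R₂ : ℝ} (hR : R₂ ≤ R₁) {Q : X → Z → ℝ} (hQ : Q ∈ dominated PX P)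
    (hmin : IsMinOn (rateObjective PX P R₁ (R₁ - R₂)) (dominated PX P) Q) :
    min (exponent₁ PX P R₁ R₂) (min (exponent₂ PX P R₁ R₂) (exponent₃ PX P R₁)) =
      (rateObjective PX P R₁ (R₁ - R₂) Q : EReal) := by
  apply le_antisymm
  · rcases le_total (mutualInfo PX Q) R₂ with h1 | h1
    · refine (min_le_left _ _).trans ?_
      have h2 : rateObjective PX P R₁ (R₁ - R₂) Q = (R₁ - R₂) + realDiv PX P Q := by
        rw [mutualInfo_eq_realInfo h hQ.1] at h1
        rw [rateObjective, min_eq_right (by linarith), max_eq_right (by linarith)]; ring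
      rw [h2, EReal.coe_add, ← condDiv_of_dominated h hQ]
      exact add_le_add le_rfl (iInf₂_le Q ⟨hQ.1, h1⟩)
    · rcases le_total (mutualInfo PX Q) R₁ with h3 | h3
      · refine (min_le_right _ _).trans <| (min_le_left _ _).trans ?_
        have h2 : rateObjective PX P R₁ (R₁ - R₂) Q =
            R₁ + (realDiv PX P Q - realInfo PX Q) := by
          rw [mutualInfo_eq_realInfo h hQ.1] at h1 h3
          rw [rateObjective, min_eq_left (by linarith), max_eq_right (by linarith)]; ring
        rw [h2, EReal.coe_add, EReal.coe_sub, ← condDiv_of_dominated h hQ,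
          ← mutualInfo_eq_realInfo h hQ.1]
        exact add_le_add le_rfl (iInf₂_le_of_le Q ⟨hQ.1, h1, h3⟩ le_rfl)
      · refine (min_le_right _ _).trans <| (min_le_right _ _).trans ?_
        have h2 : rateObjective PX P R₁ (R₁ - R₂) Q = realDiv PX P Q := by
          rw [mutualInfo_eq_realInfo h hQ.1] at h1 h3
          rw [rateObjective, max_eq_left ((min_le_left _ _).trans (by linarith))]; ring
        rw [h2, ← condDiv_of_dominated h hQ]
        exact iInf₂_le Q ⟨hQ.1, h3⟩
  · refine le_min (coe_le_coe_add_biInf fun Q' hQ' => ?_)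
      (le_min (coe_le_coe_add_biInf fun Q' hQ' => ?_) (le_iInf₂ fun Q' hQ' => ?_))
    · by_cases hd : Q' ∈ dominated PX P
      · have h1 := hmin hd
        have h2 := hQ'.2
        rw [mutualInfo_eq_realInfo h hQ'.1] at h2
        rw [condDiv_of_dominated h hd, EReal.coe_le_coe_iff]
        simp only [mem_ofPred_eq] at h1
        rw [show rateObjective PX P R₁ (R₁ - R₂) Q' = realDiv PX P Q' + (R₁ - R₂) by
          rw [rateObjective, min_eq_right (by linarith), max_eq_right (by linarith)]] at h1
        linarith
      · rw [condDiv_of_not_dominated hQ'.1 hd]; exact le_top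
    · by_cases hd : Q' ∈ dominated PX P
      · have h1 := hmin hd
        have h2 := hQ'.2
        rw [mutualInfo_eq_realInfo h hQ'.1] at h2 ⊢
        rw [condDiv_of_dominated h hd, ← EReal.coe_sub, EReal.coe_le_coe_iff]
        simp only [mem_ofPred_eq] at h1
        rw [show rateObjective PX P R₁ (R₁ - R₂) Q' = realDiv PX P Q' + (R₁ - realInfo PX Q') by
          rw [rateObjective, min_eq_left (by linarith), max_eq_right (by linarith)]] at h1
        linarith
      · rw [condDiv_of_not_dominated hQ'.1 hd, EReal.top_sub_coe]; exact le_top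
    · by_cases hd : Q' ∈ dominated PX P
      · have h1 := hmin hd
        have h2 := hQ'.2
        rw [mutualInfo_eq_realInfo h hQ'.1] at h2
        rw [condDiv_of_dominated h hd, EReal.coe_le_coe_iff]
        simp only [mem_ofPred_eq] at h1
        rw [show rateObjective PX P R₁ (R₁ - R₂) Q' = realDiv PX P Q' by
          rw [rateObjective, max_eq_left ((min_le_left _ _).trans (by linarith)), add_zero]] at h1
        exact h1
      · rw [condDiv_of_not_dominated hQ'.1 hd]; exact le_top

/-! ### The Lagrangian representation -/

/-- The Lagrangian as a real function, on the dominated channels. -/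
def realLagrangian (PX : X → ℝ) (P : X → Z → ℝ) (R₁ R₂ t₁ t₂ : ℝ) (Q : X → Z → ℝ) : ℝ :=
  realDiv PX P Q + ((t₁ + t₂ - 1) * realInfo PX Q + (1 - t₁) * R₁ - t₂ * R₂)

lemma lagrangian_of_dominated {PX : X → ℝ} (h : ∀ x, 0 ≤ PX x) {P Q : X → Z → ℝ}
    (hQ : Q ∈ dominated PX P) (R₁ R₂ t₁ t₂ : ℝ) :
    lagrangian PX P R₁ R₂ t₁ t₂ Q = (realLagrangian PX P R₁ R₂ t₁ t₂ Q : EReal) := by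
  rw [lagrangian, realLagrangian, condDiv_of_dominated h hQ, mutualInfo_eq_realInfo h hQ.1]
  exact (EReal.coe_add _ _).symm

lemma lagrangian_of_not_dominated {PX : X → ℝ} {P Q : X → Z → ℝ} (hQ : Q ∈ channels X Z)
    (hQ' : Q ∉ dominated PX P) (R₁ R₂ t₁ t₂ : ℝ) :
    lagrangian PX P R₁ R₂ t₁ t₂ Q = ⊤ := by
  rw [lagrangian, condDiv_of_not_dominated hQ hQ', EReal.top_add_coe]

lemma continuous_realLagrangian (PX : X → ℝ) (P : X → Z → ℝ) (R₁ R₂ t₁ t₂ : ℝ) :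
    Continuous (realLagrangian PX P R₁ R₂ t₁ t₂) := by
  have h1 := continuous_realDiv PX P
  have h2 := continuous_realInfo (Z := Z) PX
  unfold realLagrangian
  fun_prop

lemma exists_isMinOn_lagrangian {PX : X → ℝ} (h : ∀ x, 0 ≤ PX x) {P : X → Z → ℝ}
    (hP : P ∈ channels X Z) (R₁ R₂ t₁ t₂ : ℝ) :
    ∃ Q ∈ channels X Z, IsMinOn (lagrangian PX P R₁ R₂ t₁ t₂) (channels X Z) Q := by
  have h1 : channels X Z ∩ dominated PX P = dominated PX P :=
    inter_eq_right.2 fun Q hQ => hQ.1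
  refine exists_isMinOn_of_eq_top (PX := PX) (P := P)
    (f := realLagrangian PX P R₁ R₂ t₁ t₂) ⟨P, hP⟩ (by rw [h1]; exact isCompact_dominated PX P)
    (continuous_realLagrangian ..)
    (fun Q hQ => lagrangian_of_dominated h hQ.2 ..)
    (fun Q hQ hQ' => lagrangian_of_not_dominated hQ hQ' ..)

/-- Sion's theorem on the dominated channels, where the Lagrangian is finite and continuous.
Convexity in `Q` holds because the coefficient `t + t₂ - 1` of the mutual information is at least
`-1`. -/
lemma exists_saddlePoint {PX : X → ℝ} (h : ∀ x, 0 ≤ PX x) {P : X → Z → ℝ}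
    (hP : P ∈ channels X Z) (R₁ R₂ : ℝ) {t₂ : ℝ} (ht₂ : t₂ ∈ Icc (0 : ℝ) 1) :
    ∃ Q ∈ dominated PX P, ∃ t₁ ∈ Icc (0 : ℝ) 1,
      (∀ t ∈ Icc (0 : ℝ) 1,
        realLagrangian PX P R₁ R₂ t t₂ Q ≤ realLagrangian PX P R₁ R₂ t₁ t₂ Q) ∧
      (∀ Q' ∈ dominated PX P,
        realLagrangian PX P R₁ R₂ t₁ t₂ Q ≤ realLagrangian PX P R₁ R₂ t₁ t₂ Q') := by
  obtain ⟨Q, hQ, t₁, ht₁, hs⟩ := Sion.exists_isSaddlePointOn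
    (X := dominated PX P) (Y := Icc (0 : ℝ) 1)
    (f := fun Q t => realLagrangian PX P R₁ R₂ t t₂ Q)
    ⟨P, mem_dominated_self hP⟩ (convex_dominated PX P) (isCompact_dominated PX P)
    (fun t _ => (continuous_realLagrangian PX P R₁ R₂ t t₂).continuousOn.lowerSemicontinuousOn)
    (fun t ht => by
      refine ConvexOn.quasiconvexOn ?_
      have h1 := ((convexOn_realDiv_add h P (c := t + t₂ - 1)
        (by linarith [ht.1, ht₂.1])).add_const ((1 - t) * R₁ - t₂ * R₂)).subset
        (fun Q hQ => hQ.1) (convex_dominated PX P)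
      refine h1.congr fun Q _ => ?_
      simp only [realLagrangian, Pi.add_apply]; ring)
    (convex_Icc 0 1) ⟨0, by simp⟩ isCompact_Icc
    (fun Q _ => by
      refine ContinuousOn.upperSemicontinuousOn (Continuous.continuousOn ?_)
      unfold realLagrangian; fun_prop)
    (fun Q _ => by
      refine ConcaveOn.quasiconcaveOn ⟨convex_Icc 0 1, fun s _ t _ a b _ _ hab => ?_⟩
      have hb : b = 1 - a := by linarith
      subst hb
      simp only [realLagrangian, smul_eq_mul]
      apply le_of_eq; ring)
  exact ⟨Q, hQ, t₁, ht₁, fun t ht => hs Q hQ t ht |>.trans le_rfl,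
    fun Q' hQ' => hs Q' hQ' t₁ ht₁⟩

lemma innerMin_eq_of_forall_le {PX : X → ℝ} (h : ∀ x, 0 ≤ PX x) {P Q : X → Z → ℝ}
    (hQ : Q ∈ dominated PX P) {R₁ R₂ t₁ t₂ : ℝ}
    (hmin : ∀ Q' ∈ dominated PX P,
      realLagrangian PX P R₁ R₂ t₁ t₂ Q ≤ realLagrangian PX P R₁ R₂ t₁ t₂ Q') :
    innerMin PX P R₁ R₂ t₁ t₂ = (realLagrangian PX P R₁ R₂ t₁ t₂ Q : EReal) := by
  apply le_antisymm
  · rw [← lagrangian_of_dominated h hQ]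
    exact iInf₂_le Q hQ.1
  · refine le_iInf₂ fun Q' hQ' => ?_
    by_cases hd : Q' ∈ dominated PX P
    · rw [lagrangian_of_dominated h hd]
      exact EReal.coe_le_coe_iff.2 (hmin Q' hd)
    · rw [lagrangian_of_not_dominated hQ' hd]; exact le_top

lemma innerMin_le {PX : X → ℝ} (h : ∀ x, 0 ≤ PX x) {P Q : X → Z → ℝ}
    (hQ : Q ∈ dominated PX P) (R₁ R₂ t₁ t₂ : ℝ) :
    innerMin PX P R₁ R₂ t₁ t₂ ≤ (realLagrangian PX P R₁ R₂ t₁ t₂ Q : EReal) := by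
  rw [← lagrangian_of_dominated h hQ]
  exact iInf₂_le Q hQ.1

lemma exists_isMaxOn_innerMin {PX : X → ℝ} (h : ∀ x, 0 ≤ PX x) {P : X → Z → ℝ}
    (hP : P ∈ channels X Z) (R₁ R₂ : ℝ) {t₂ : ℝ} (ht₂ : t₂ ∈ Icc (0 : ℝ) 1) :
    ∃ t₁ ∈ Icc (0 : ℝ) 1, IsMaxOn (fun t => innerMin PX P R₁ R₂ t t₂) (Icc (0 : ℝ) 1) t₁ := by
  obtain ⟨Q, hQ, t₁, ht₁, hmax, hmin⟩ := exists_saddlePoint h hP R₁ R₂ ht₂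
  refine ⟨t₁, ht₁, fun t ht => ?_⟩
  simp only [mem_ofPred_eq, innerMin_eq_of_forall_le h hQ hmin]
  exact (innerMin_le h hQ ..).trans (EReal.coe_le_coe_iff.2 (hmax t ht))

/-- At the channel `Q'` of the saddle point, `t₁` does at least as well as the endpoints `0` and
`1`, where the bracket is `R₁ - I + t₂ (I - R₂)` and `t₂ (I - R₂)`. For any `t₂ ∈ [0,1]` the larger
of these is at least the bracket of `rateObjective`. -/
lemma le_middleMax {PX : X → ℝ} (h : ∀ x, 0 ≤ PX x) {P : X → Z → ℝ}
    (hP : P ∈ channels X Z) {R₁ R₂ : ℝ} (hR : R₂ ≤ R₁) {Q : X → Z → ℝ}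
    (hmin : IsMinOn (rateObjective PX P R₁ (R₁ - R₂)) (dominated PX P) Q)
    {t₂ : ℝ} (ht₂ : t₂ ∈ Icc (0 : ℝ) 1) :
    (rateObjective PX P R₁ (R₁ - R₂) Q : EReal) ≤ middleMax PX P R₁ R₂ t₂ := by
  obtain ⟨Q', hQ', t₁, ht₁, hmax, hmin'⟩ := exists_saddlePoint h hP R₁ R₂ ht₂
  refine le_trans ?_ (le_iSup₂ t₁ ht₁)
  rw [innerMin_eq_of_forall_le h hQ' hmin', EReal.coe_le_coe_iff]
  refine (hmin hQ').trans ?_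
  have h0 := hmax 0 (by simp)
  have h1 := hmax 1 (by simp)
  rw [realLagrangian] at h0 h1
  have h2 : rateObjective PX P R₁ (R₁ - R₂) Q' ≤
      max (realDiv PX P Q' + ((0 + t₂ - 1) * realInfo PX Q' + (1 - 0) * R₁ - t₂ * R₂))
        (realDiv PX P Q' + ((1 + t₂ - 1) * realInfo PX Q' + (1 - 1) * R₁ - t₂ * R₂)) := by
    rw [rateObjective]
    obtain ⟨h3, h4⟩ := ht₂
    rcases le_total (realInfo PX Q') R₂ with h5 | h5
    · rw [min_eq_right (by linarith), max_eq_right (by linarith)]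
      refine le_max_of_le_left ?_
      nlinarith
    · rcases le_total (realInfo PX Q') R₁ with h6 | h6
      · rw [min_eq_left (by linarith), max_eq_right (by linarith)]
        refine le_max_of_le_left ?_
        nlinarith
      · rw [max_eq_left ((min_le_left _ _).trans (by linarith))]
        refine le_max_of_le_right ?_
        nlinarith
  exact h2.trans (max_le h0 h1)

/-- An endpoint suffices: with `t₂ = 1` for `I ≤ R₂` and `t₂ = 0` otherwise, the Lagrangian at `Q`
is at most the objective for every `t₁`. -/
lemma exists_middleMax_le {PX : X → ℝ} (h : ∀ x, 0 ≤ PX x) {P : X → Z → ℝ}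
    {R₁ R₂ : ℝ} (hR : R₂ ≤ R₁) {Q : X → Z → ℝ} (hQ : Q ∈ dominated PX P) :
    ∃ t₂ ∈ Icc (0 : ℝ) 1,
      middleMax PX P R₁ R₂ t₂ ≤ (rateObjective PX P R₁ (R₁ - R₂) Q : EReal) := by
  rcases le_total (realInfo PX Q) R₂ with h1 | h1
  · refine ⟨1, by simp, iSup₂_le fun t₁ ht₁ => (innerMin_le h hQ ..).trans ?_⟩
    rw [EReal.coe_le_coe_iff, rateObjective, realLagrangian, min_eq_right (by linarith),
      max_eq_right (by linarith)]
    nlinarith [ht₁.1, ht₁.2]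
  · refine ⟨0, by simp, iSup₂_le fun t₁ ht₁ => (innerMin_le h hQ ..).trans ?_⟩
    rw [EReal.coe_le_coe_iff, rateObjective, realLagrangian, min_eq_left (by linarith)]
    rcases le_total (realInfo PX Q) R₁ with h2 | h2
    · rw [max_eq_right (by linarith)]
      nlinarith [ht₁.1, ht₁.2]
    · rw [max_eq_left (by linarith)]
      nlinarith [ht₁.1, ht₁.2]

lemma biInf_middleMax_eq {PX : X → ℝ} (h : ∀ x, 0 ≤ PX x) {P : X → Z → ℝ}
    (hP : P ∈ channels X Z) {R₁ R₂ : ℝ} (hR : R₂ ≤ R₁) {Q : X → Z → ℝ}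
    (hQ : Q ∈ dominated PX P)
    (hmin : IsMinOn (rateObjective PX P R₁ (R₁ - R₂)) (dominated PX P) Q) :
    ⨅ t₂ ∈ Icc (0 : ℝ) 1, middleMax PX P R₁ R₂ t₂ =
      (rateObjective PX P R₁ (R₁ - R₂) Q : EReal) := by
  obtain ⟨t₂, ht₂, hle⟩ := exists_middleMax_le h hR hQ
  exact le_antisymm (iInf₂_le_of_le t₂ ht₂ hle)
    (le_iInf₂ fun t ht => le_middleMax h hP hR hmin ht)

lemma exists_isMinOn_middleMax {PX : X → ℝ} (h : ∀ x, 0 ≤ PX x) {P : X → Z → ℝ}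
    (hP : P ∈ channels X Z) {R₁ R₂ : ℝ} (hR : R₂ ≤ R₁) :
    ∃ t₂ ∈ Icc (0 : ℝ) 1, IsMinOn (middleMax PX P R₁ R₂) (Icc (0 : ℝ) 1) t₂ := by
  obtain ⟨Q, hQ, hmin⟩ := exists_isMinOn_rateObjective (PX := PX) hP R₁ (R₁ - R₂)
  obtain ⟨t₂, ht₂, hle⟩ := exists_middleMax_le h hR hQ
  exact ⟨t₂, ht₂, fun t ht => hle.trans (le_middleMax h hP hR hmin ht)⟩


/-! ### Sequences with prescribed letter counts -/

open Classical in
/-- The number of occurrences of each letter in a sequence. -/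
def counts {A : Type*} {n : ℕ} (f : Fin n → A) (a : A) : ℕ :=
  (Finset.univ.filter fun i => f i = a).card

open Classical in
/-- The sequences of length `n` with letter counts `k`. -/
def seqsWithCounts {A : Type*} [Fintype A] (n : ℕ) (k : A → ℕ) : Finset (Fin n → A) :=
  Finset.univ.filter fun f => counts f = k

section Counts

variable {A B : Type*} [Fintype A] [Fintype B] {n : ℕ}

lemma mem_seqsWithCounts {k : A → ℕ} {f : Fin n → A} :
    f ∈ seqsWithCounts n k ↔ counts f = k := by
  simp [seqsWithCounts]

lemma sum_counts (f : Fin n → A) : ∑ a, counts f a = n := by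
  classical
  have h := Finset.card_eq_sum_card_fiberwise (f := f) (s := Finset.univ) (t := Finset.univ)
    (fun _ _ => by simp)
  rw [Finset.card_univ, Fintype.card_fin] at h
  refine Eq.trans (Finset.sum_congr rfl fun a _ => ?_) h.symm
  unfold counts
  congr

lemma counts_le (f : Fin n → A) (a : A) : counts f a ≤ n := by
  classical
  exact (Finset.card_le_univ _).trans_eq (Fintype.card_fin n)

lemma counts_map (f : Fin n → A) (g : A → B) (b : B) [DecidableEq B] :
    counts (g ∘ f) b = ∑ a ∈ Finset.univ.filter (fun a => g a = b), counts f a := by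
  classical
  unfold counts
  rw [← Finset.card_biUnion]
  · congr 1
    ext i
    simp
  · intro a _ a' _ haa'
    rw [Function.onFun, Finset.disjoint_left]
    intro i hi hi'
    simp only [Finset.mem_filter, Finset.mem_univ, true_and] at hi hi'
    exact haa' (hi.symm.trans hi')

lemma prod_comp_counts (f : Fin n → A) (p : A → ℝ) :
    ∏ i, p (f i) = ∏ a, p a ^ counts f a := by
  classical
  rw [← Finset.prod_fiberwise (s := Finset.univ) (g := f)]
  refine Finset.prod_congr rfl fun a _ => ?_
  rw [Finset.prod_congr rfl (g := fun _ => p a), Finset.prod_const]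
  · unfold counts; congr
  · intro i hi
    rw [(Finset.mem_filter.1 hi).2]

lemma counts_comp_perm (f : Fin n → A) (σ : Equiv.Perm (Fin n)) :
    counts (f ∘ σ) = counts f := by
  classical
  funext a
  unfold counts
  refine Finset.card_bij (fun i _ => σ i) ?_ ?_ ?_
  · intro i hi; simpa using hi
  · intro i _ j _ h; exact σ.injective h
  · intro i hi; exact ⟨σ.symm i, by simpa using hi, by simp⟩

/-- For each letter its sets of positions in `f` and in `g` have equal size; the bijections between
them glue to a permutation. -/
lemma exists_perm_of_counts_eq {f g : Fin n → A} (h : counts f = counts g) :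
    ∃ σ : Equiv.Perm (Fin n), f = g ∘ σ := by
  classical
  have e : ∀ a, {i // f i = a} ≃ {i // g i = a} := fun a =>
    Fintype.equivOfCardEq <| by
      have h1 := congrFun h a
      rw [Fintype.card_subtype, Fintype.card_subtype]
      unfold counts at h1
      convert h1
  exact ⟨Equiv.ofFiberEquiv e, funext fun i => (Equiv.ofFiberEquiv_map e i).symm⟩

lemma exists_counts_eq {k : A → ℕ} (hk : ∑ a, k a = n) : ∃ f : Fin n → A, counts f = k := by
  classical
  have e : Fin n ≃ Σ a, Fin (k a) := Fintype.equivOfCardEq <| by simp [hk]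
  refine ⟨fun i => (e i).1, funext fun a => ?_⟩
  unfold counts
  rw [← Fintype.card_fin (k a), ← Fintype.card_subtype]
  refine Fintype.card_congr ((e.subtypeEquiv (q := fun s => s.1 = a) fun _ => Iff.rfl).trans ?_)
  exact Equiv.sigmaSubtype a

/-- Orbit and stabilizer for the permutations of positions: the fibres of `σ ↦ f ∘ σ` are cosets of
the stabilizer of `f`, which has `∏ (k a)!` elements. -/
lemma card_seqsWithCounts_mul_prod {k : A → ℕ} (hk : ∑ a, k a = n) :
    (seqsWithCounts n k).card * ∏ a, (k a).factorial = n.factorial := by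
  classical
  obtain ⟨f, hf⟩ := exists_counts_eq hk
  have h1 : (Finset.univ : Finset (Equiv.Perm (Fin n))).card = n.factorial := by
    rw [Finset.card_univ, Fintype.card_perm, Fintype.card_fin]
  have h2 : ∏ a, (k a).factorial =
      (Finset.univ.filter fun σ : Equiv.Perm (Fin n) => f ∘ σ = f).card := by
    rw [← Fintype.card_subtype, DomMulAct.stabilizer_card f]
    refine Finset.prod_congr rfl fun a _ => ?_
    rw [Fintype.card_subtype, ← hf]
    unfold counts
    congr
  rw [← h1, Finset.card_eq_sum_card_fiberwise (f := fun σ : Equiv.Perm (Fin n) => f ∘ σ)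
    (t := seqsWithCounts n k)
    (fun σ _ => by simp [mem_seqsWithCounts, counts_comp_perm, hf]), h2, ← smul_eq_mul,
    ← Finset.sum_const]
  refine Finset.sum_congr rfl fun g hg => ?_
  obtain ⟨τ, rfl⟩ := exists_perm_of_counts_eq ((mem_seqsWithCounts.1 hg).trans hf.symm)
  refine Finset.card_bij (fun σ _ => σ * τ) ?_ ?_ ?_
  · intro σ hσ
    simp only [Finset.mem_filter, Finset.mem_univ, true_and] at hσ ⊢
    rw [Equiv.Perm.coe_mul, ← Function.comp_assoc, hσ]
  · intro σ _ σ' _ h; exact mul_right_cancel h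
  · intro σ hσ
    simp only [Finset.mem_filter, Finset.mem_univ, true_and] at hσ
    refine ⟨σ * τ⁻¹, ?_, by simp⟩
    simp only [Finset.mem_filter, Finset.mem_univ, true_and]
    rw [Equiv.Perm.coe_mul, ← Function.comp_assoc, hσ, Function.comp_assoc, ← Equiv.Perm.coe_mul]
    simp

end Counts

/-! ### Logarithms of factorials and of type class sizes -/

/-- Stirling's formula up to a factor `e k`, which is harmless at exponential scale. The induction
compares increments by `1/(k+1) ≤ log (k+1) - log k ≤ 1/k`; at `k = 0` the convention `log 0 = 0`
makes both bounds true. -/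
lemma log_factorial_bounds (k : ℕ) :
    (k : ℝ) * Real.log k - k ≤ Real.log k.factorial ∧
      Real.log k.factorial ≤ k * Real.log k - k + 1 + Real.log k := by
  induction k with
  | zero => simp
  | succ k ih =>
    rcases Nat.eq_zero_or_pos k with h0 | h0
    · subst h0; simp
    have hk : (0 : ℝ) < k := by exact_mod_cast h0
    have h1 : Real.log ((k + 1).factorial : ℕ) =
        Real.log (k + 1) + Real.log (k.factorial : ℕ) := by
      rw [Nat.factorial_succ]
      push_cast
      exact Real.log_mul (by positivity) (by positivity)
    have h2 : Real.log (k + 1) - Real.log k ≤ 1 / k := by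
      rw [← Real.log_div (by positivity) (by positivity)]
      refine (Real.log_le_sub_one_of_pos (by positivity)).trans (le_of_eq ?_)
      field_simp
      ring
    have h3 : 1 / ((k : ℝ) + 1) ≤ Real.log (k + 1) - Real.log k := by
      have h4 := Real.log_le_sub_one_of_pos (x := (k : ℝ) / (k + 1)) (by positivity)
      rw [Real.log_div (by positivity) (by positivity)] at h4
      have h5 : (k : ℝ) / (k + 1) - 1 = -(1 / (k + 1)) := by field_simp; ring
      linarith
    have h4 : (k : ℝ) * (Real.log (k + 1) - Real.log k) ≤ 1 := by
      have := mul_le_mul_of_nonneg_left h2 hk.le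
      rwa [mul_one_div_cancel hk.ne'] at this
    have h5 : 1 ≤ ((k : ℝ) + 1) * (Real.log (k + 1) - Real.log k) := by
      have := mul_le_mul_of_nonneg_left h3 (by positivity : (0 : ℝ) ≤ k + 1)
      rwa [mul_one_div_cancel (by positivity)] at this
    rw [h1]
    push_cast
    constructor <;> nlinarith [ih.1, ih.2]

/-- `k log k`, summed over a finite family of counts. -/
def sumMulLog {A : Type*} [Fintype A] (k : A → ℕ) : ℝ :=
  ∑ a, (k a : ℝ) * Real.log (k a)

/-- The linear terms of the factorial bounds cancel because the counts sum to `n`. Each of the `|A|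
+ 1` factorials costs at most `1 + log (n + 1)`. -/
lemma abs_log_card_seqsWithCounts_sub_le {A : Type*} [Fintype A] {n : ℕ} {k : A → ℕ}
    (hk : ∑ a, k a = n) :
    |Real.log (seqsWithCounts n k).card - (n * Real.log n - sumMulLog k)| ≤
      (Fintype.card A + 1) * (1 + Real.log (n + 1)) := by
  have h1 := card_seqsWithCounts_mul_prod hk
  have h2 : Real.log (seqsWithCounts n k).card =
      Real.log n.factorial - ∑ a, Real.log (k a).factorial := by
    have hpos : ((seqsWithCounts n k).card : ℝ) ≠ 0 := by
      intro h0
      have : (seqsWithCounts n k).card = 0 := by exact_mod_cast h0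
      rw [this, zero_mul] at h1
      exact n.factorial_ne_zero h1.symm
    rw [← h1, ← Real.log_prod (fun a _ => by positivity)]
    push_cast
    rw [Real.log_mul hpos (Finset.prod_ne_zero_iff.2 fun a _ => by positivity)]
    ring
  have hkn : ∀ a, k a ≤ n := fun a => hk ▸ Finset.single_le_sum (fun _ _ => Nat.zero_le _)
    (Finset.mem_univ a)
  have hlog : ∀ j : ℕ, j ≤ n → Real.log j ≤ Real.log (n + 1) := by
    intro j hj
    rcases Nat.eq_zero_or_pos j with h0 | h0
    · subst h0; simpa using Real.log_nonneg (by linarith [Nat.cast_nonneg (α := ℝ) n])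
    · have h4 : (j : ℝ) ≤ n := by exact_mod_cast hj
      exact Real.log_le_log (by exact_mod_cast h0) (by linarith)
  have hsum : ∑ a, (k a : ℝ) = n := by exact_mod_cast hk
  have hlow : sumMulLog k - n ≤ ∑ a, Real.log (k a).factorial := by
    rw [sumMulLog, ← hsum, ← Finset.sum_sub_distrib]
    exact Finset.sum_le_sum fun a _ => (log_factorial_bounds (k a)).1
  have hup : ∑ a, Real.log (k a).factorial ≤
      sumMulLog k - n + Fintype.card A * (1 + Real.log (n + 1)) := by
    have : sumMulLog k - n + Fintype.card A * (1 + Real.log (n + 1)) =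
        ∑ a, ((k a : ℝ) * Real.log (k a) - k a + (1 + Real.log (n + 1))) := by
      rw [Finset.sum_add_distrib, Finset.sum_sub_distrib, hsum, sumMulLog]
      simp only [Finset.sum_const, Finset.card_univ, nsmul_eq_mul]
    rw [this]
    refine Finset.sum_le_sum fun a _ => ?_
    have h5 := (log_factorial_bounds (k a)).2
    have h6 := hlog (k a) (hkn a)
    linarith
  have hn := log_factorial_bounds n
  have hn' := hlog n le_rfl
  have h0 : 0 ≤ Real.log ((n : ℝ) + 1) :=
    Real.log_nonneg (by linarith [Nat.cast_nonneg (α := ℝ) n])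
  have h7 : 0 ≤ (Fintype.card A : ℝ) * (1 + Real.log (n + 1)) := by positivity
  rw [h2, abs_le]
  constructor <;> linarith [hn.1, hn.2]


/-! ### Uniform random codebooks -/

section Ensemble

open scoped BigOperators

variable {α : Type*} {M M₂ : ℕ}

/-- The arrays all of whose entries belong to `T`. -/
def arrays (M M₂ : ℕ) (T : Finset α) : Finset (Fin M → Fin M₂ → α) :=
  Fintype.piFinset fun _ => Fintype.piFinset fun _ => T

lemma arrays_nonempty {T : Finset α} (hT : T.Nonempty) : (arrays M M₂ T).Nonempty := by
  simpa [arrays, Fintype.piFinset_nonempty] using fun _ _ => hT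

lemma mem_arrays {T : Finset α} {C : Fin M → Fin M₂ → α} :
    C ∈ arrays M M₂ T ↔ ∀ w b, C w b ∈ T := by
  simp [arrays]

/-- The expectation of a product of functions of the individual entries factorizes. -/
lemma expect_arrays_prod (T : Finset α) (g : Fin M → Fin M₂ → α → ℝ) :
    𝔼 C ∈ arrays M M₂ T, ∏ w, ∏ b, g w b (C w b) = ∏ w, ∏ b, 𝔼 x ∈ T, g w b x := by
  simp only [Finset.expect_eq_sum_div_card, Finset.prod_div_distrib]
  congr 1
  · rw [arrays, Finset.sum_prod_piFinset _ fun (w : Fin M) (c : Fin M₂ → α) => ∏ b, g w b (c b)]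
    exact Finset.prod_congr rfl fun w _ => Finset.sum_prod_piFinset _ _
  · simp [arrays, Fintype.card_piFinset]

/-- The product formula with all other factors equal to `1`. -/
lemma expect_arrays_apply {T : Finset α} (hT : T.Nonempty) (φ : α → ℝ) (w : Fin M)
    (b : Fin M₂) : 𝔼 C ∈ arrays M M₂ T, φ (C w b) = 𝔼 x ∈ T, φ x := by
  have h := expect_arrays_prod T fun (w' : Fin M) (b' : Fin M₂) x =>
    if w' = w ∧ b' = b then φ x else 1
  have h1 : ∀ f : Fin M → Fin M₂ → ℝ,
      (∀ w' b', ¬ (w' = w ∧ b' = b) → f w' b' = 1) → ∏ w', ∏ b', f w' b' = f w b := by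
    intro f hf
    rw [Finset.prod_eq_single w, Finset.prod_eq_single b]
    · exact fun b' _ hb' => hf _ _ fun h => hb' h.2
    · simp
    · exact fun w' _ hw' => Finset.prod_eq_one fun b' _ => hf _ _ fun h => hw' h.1
    · simp
  rw [h1 (fun w' b' => 𝔼 x ∈ T, if w' = w ∧ b' = b then φ x else 1)] at h
  · simp only [and_self, if_true] at h
    rw [← h]
    refine Finset.expect_congr rfl fun C _ => ?_
    rw [h1 (fun w' b' => if w' = w ∧ b' = b then φ (C w' b') else 1)]
    · simp
    · intro w' b' hwb; rw [if_neg hwb]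
  · intro w' b' hwb
    simp only [if_neg hwb]
    exact Finset.expect_const hT 1

open Classical in
/-- The number of entries of `c` in `A`. -/
def hits (A : Finset α) (c : Fin M₂ → α) : ℝ :=
  ∑ b, if c b ∈ A then 1 else 0

open Classical in
/-- The fraction of `T` occupied by `A`. -/
def frac (T A : Finset α) : ℝ :=
  𝔼 x ∈ T, if x ∈ A then 1 else 0

lemma hits_nonneg (A : Finset α) (c : Fin M₂ → α) : 0 ≤ hits A c :=
  Finset.sum_nonneg fun b _ => by split_ifs <;> simp

lemma one_le_hits {A : Finset α} {c : Fin M₂ → α} {b : Fin M₂} (h : c b ∈ A) :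
    1 ≤ hits A c := by
  classical
  have h1 := Finset.single_le_sum (f := fun b => if c b ∈ A then (1 : ℝ) else 0)
    (fun b _ => by split_ifs <;> simp) (Finset.mem_univ b)
  rw [if_pos h] at h1
  unfold hits
  convert h1

lemma frac_nonneg (T A : Finset α) : 0 ≤ frac T A :=
  Finset.expect_nonneg fun b _ => by split_ifs <;> simp

lemma frac_le_one {T : Finset α} (hT : T.Nonempty) (A : Finset α) : frac T A ≤ 1 :=
  Finset.expect_le hT fun b _ => by split_ifs <;> simp

lemma frac_eq_card_div {T A : Finset α} (h : A ⊆ T) : frac T A = A.card / T.card := by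
  classical
  rw [frac, Finset.expect_eq_sum_div_card, Finset.sum_boole]
  congr 2
  rw [Finset.filter_mem_eq_inter, Finset.inter_eq_right.2 h]

lemma expect_hits {T : Finset α} (hT : T.Nonempty) (A : Finset α) (w : Fin M) :
    𝔼 C ∈ arrays M M₂ T, hits A (C w) = M₂ * frac T A := by
  classical
  unfold hits
  rw [Finset.expect_sum_comm]
  simp only [expect_arrays_apply hT (fun x => if x ∈ A then (1 : ℝ) else 0) w]
  simp [frac]

/-- The entries of a row are independent, and each contributes `𝔼 exp(1_A) ≤ 1 + 2p ≤ exp(2p)` with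
`p = frac T A`, since `e ≤ 3`. -/
lemma expect_exp_hits_le {T : Finset α} (hT : T.Nonempty) (A : Finset α) (w : Fin M) :
    𝔼 C ∈ arrays M M₂ T, Real.exp (hits A (C w)) ≤ Real.exp (2 * (M₂ * frac T A)) := by
  classical
  have h := expect_arrays_prod T fun (w' : Fin M) (_ : Fin M₂) x =>
    if w' = w then Real.exp (if x ∈ A then 1 else 0) else 1
  have h1 : ∀ f : Fin M → Fin M₂ → ℝ,
      (∀ w' b', w' ≠ w → f w' b' = 1) → ∏ w', ∏ b', f w' b' = ∏ b, f w b := by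
    intro f hf
    rw [Finset.prod_eq_single w]
    · exact fun w' _ hw' => Finset.prod_eq_one fun b' _ => hf _ _ hw'
    · simp
  have h2 : 𝔼 C ∈ arrays M M₂ T, Real.exp (hits A (C w)) =
      ∏ _b : Fin M₂, 𝔼 x ∈ T, Real.exp (if x ∈ A then 1 else 0) := by
    rw [h1 (fun w' b' => 𝔼 x ∈ T, if w' = w then Real.exp (if x ∈ A then 1 else 0) else 1)] at h
    · simp only [if_true] at h
      rw [← h]
      refine Finset.expect_congr rfl fun C _ => ?_
      rw [h1 (fun w' b' => if w' = w then Real.exp (if C w' b' ∈ A then 1 else 0) else 1)]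
      · simp only [if_true]
        rw [hits, Real.exp_sum]
      · intro w' b' hwb; rw [if_neg hwb]
    · intro w' b' hwb
      simp only [if_neg hwb]
      exact Finset.expect_const hT 1
  have h3 : 𝔼 x ∈ T, Real.exp (if x ∈ A then 1 else 0) ≤ Real.exp (2 * frac T A) := by
    have h4 : ∀ x, Real.exp (if x ∈ A then 1 else 0) ≤ 1 + 2 * (if x ∈ A then 1 else 0) := by
      intro x
      split_ifs
      · linarith [Real.exp_one_lt_d9]
      · simp
    refine (Finset.expect_le_expect fun x _ => h4 x).trans ?_
    rw [Finset.expect_add_distrib, Finset.expect_const hT, ← Finset.mul_expect, add_comm]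
    exact Real.add_one_le_exp _
  rw [h2, Finset.prod_const, Finset.card_univ, Fintype.card_fin]
  refine (pow_le_pow_left₀ (Finset.expect_nonneg fun x _ => (Real.exp_pos _).le) h3 _).trans ?_
  rw [← Real.exp_nat_mul]
  apply le_of_eq; congr 1; ring

/-- A selected row has on average no more hits than all rows together. -/
lemma expect_hits_selected_le_mul {T : Finset α} (hT : T.Nonempty) (A : Finset α)
    (d : (Fin M → Fin M₂ → α) → Fin M) :
    𝔼 C ∈ arrays M M₂ T, hits A (C (d C)) ≤ M * M₂ * frac T A := by
  have h : 𝔼 C ∈ arrays M M₂ T, hits A (C (d C)) ≤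
      𝔼 C ∈ arrays M M₂ T, ∑ w, hits A (C w) :=
    Finset.expect_le_expect fun C _ => Finset.single_le_sum (f := fun w => hits A (C w))
      (fun w _ => hits_nonneg _ _) (Finset.mem_univ _)
  rw [Finset.expect_sum_comm] at h
  simp only [expect_hits hT, Finset.sum_const, Finset.card_univ, Fintype.card_fin,
    nsmul_eq_mul] at h
  linarith

/-- A selected row has on average at most `log M` hits plus twice the mean of a single row. -/
lemma expect_hits_selected_le_log {T : Finset α} (hT : T.Nonempty) (A : Finset α) (hM : 0 < M)
    (d : (Fin M → Fin M₂ → α) → Fin M) :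
    𝔼 C ∈ arrays M M₂ T, hits A (C (d C)) ≤ Real.log M + 2 * (M₂ * frac T A) := by
  have hM' : (0 : ℝ) < M := by exact_mod_cast hM
  -- `a` bounds the mean of `∑ w, exp (hits A (C w))`. The tangent of the logarithm at `a` then
  -- gives Jensen's bound for the selected row.
  set a : ℝ := M * Real.exp (2 * (M₂ * frac T A)) with ha
  have ha0 : 0 < a := by positivity
  have hlog : Real.log a = Real.log M + 2 * (M₂ * frac T A) := by
    rw [ha, Real.log_mul hM'.ne' (Real.exp_pos _).ne', Real.log_exp]
  have h1 : ∀ t : ℝ, t ≤ Real.log a - 1 + Real.exp t / a := by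
    intro t
    have h2 := Real.log_le_sub_one_of_pos (x := Real.exp t / a) (by positivity)
    rw [Real.log_div (Real.exp_pos _).ne' ha0.ne', Real.log_exp] at h2
    linarith
  have h2 : ∀ C : Fin M → Fin M₂ → α, hits A (C (d C)) ≤
      Real.log a - 1 + (∑ w, Real.exp (hits A (C w))) / a := by
    intro C
    refine (h1 _).trans ?_
    gcongr
    exact Finset.single_le_sum (f := fun w => Real.exp (hits A (C w)))
      (fun w _ => (Real.exp_pos _).le) (Finset.mem_univ _)
  refine (Finset.expect_le_expect fun C _ => h2 C).trans ?_
  rw [Finset.expect_add_distrib, Finset.expect_const (arrays_nonempty hT), ← Finset.expect_div,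
    Finset.expect_sum_comm, ← hlog]
  have h3 : (∑ w : Fin M, 𝔼 C ∈ arrays M M₂ T, Real.exp (hits A (C w))) / a ≤ 1 := by
    rw [div_le_one ha0, ha]
    refine (Finset.sum_le_sum fun w _ => expect_exp_hits_le hT A w).trans ?_
    simp
  linarith

open Classical in
/-- Lower bound on the probability that some entry is in `A`. -/
lemma le_expect_exists_mem {T : Finset α} (hT : T.Nonempty) (A : Finset α) :
    1 / 2 * min 1 (M * M₂ * frac T A) ≤
      𝔼 C ∈ arrays M M₂ T, if ∃ w b, C w b ∈ A then (1 : ℝ) else 0 := by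
  -- The event fails exactly when the product of all miss indicators is `1`, and the mean of that
  -- product factorizes.
  have h1 : ∀ C : Fin M → Fin M₂ → α, (if ∃ w b, C w b ∈ A then (1 : ℝ) else 0) =
      1 - ∏ w, ∏ b, (1 - if C w b ∈ A then 1 else 0) := by
    intro C
    split_ifs with h
    · obtain ⟨w, b, h⟩ := h
      rw [Finset.prod_eq_zero (Finset.mem_univ w)
        (Finset.prod_eq_zero (Finset.mem_univ b) (by rw [if_pos h, sub_self])), sub_zero]
    · push Not at h
      simp [h]
  have h2 : 𝔼 C ∈ arrays M M₂ T, (if ∃ w b, C w b ∈ A then (1 : ℝ) else 0) =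
      1 - ((1 - frac T A) ^ M₂) ^ M := by
    simp only [h1]
    rw [Finset.expect_sub_distrib, Finset.expect_const (arrays_nonempty hT),
      expect_arrays_prod T fun _ _ x => (1 : ℝ) - if x ∈ A then 1 else 0,
      Finset.expect_sub_distrib, Finset.expect_const hT]
    simp [frac]
  rw [h2, ← pow_mul]
  set p := frac T A with hp
  have hp0 := frac_nonneg T A
  have hp1 := frac_le_one hT A
  have h3 : (1 - p) ^ (M₂ * M) ≤ Real.exp (-(M * M₂ * p)) := by
    refine (pow_le_pow_left₀ (by linarith) (Real.one_sub_le_exp_neg p) _).trans ?_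
    rw [← Real.exp_nat_mul]
    apply le_of_eq; congr 1; push_cast; ring
  set t : ℝ := M * M₂ * p with ht
  have ht0 : 0 ≤ t := by positivity
  -- Here `t` is the mean number of hits, and `1 - exp(-t) ≥ t / (1 + t) ≥ min(1, t) / 2`.
  have h4 : Real.exp (-t) ≤ 1 / (1 + t) := by
    rw [Real.exp_neg, ← one_div]
    exact one_div_le_one_div_of_le (by linarith) (by linarith [Real.add_one_le_exp t])
  have h5 : 1 / (1 + t) ≤ 1 - 1 / 2 * min 1 t := by
    rw [div_le_iff₀ (by linarith)]
    rcases le_total 1 t with h | h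
    · rw [min_eq_left h]; linarith
    · rw [min_eq_right h]; nlinarith
  linarith

end Ensemble

/-! ### The average probability of correct decoding in terms of joint types -/

section JointTypes

open scoped BigOperators

variable {n M M₂ : ℕ}

/-- The joint letter counts of a pair of sequences. -/
def jointCounts (x : Fin n → X) (z : Fin n → Z) : X × Z → ℕ :=
  counts fun i => (x i, z i)

/-- The second marginal of joint letter counts. -/
def sndCounts (J : X × Z → ℕ) (z : Z) : ℕ := ∑ x, J (x, z)

/-- The first marginal of joint letter counts. -/
def fstCounts (J : X × Z → ℕ) (x : X) : ℕ := ∑ z, J (x, z)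

lemma sndCounts_jointCounts (x : Fin n → X) (z : Fin n → Z) :
    sndCounts (jointCounts x z) = counts z := by
  classical
  funext c
  have h := counts_map (fun i => (x i, z i)) Prod.snd c
  rw [show (Prod.snd ∘ fun i => (x i, z i)) = z from rfl] at h
  rw [h, sndCounts]
  refine Finset.sum_nbij' (fun a => (a, c)) Prod.fst ?_ ?_ ?_ ?_ ?_ <;> simp [jointCounts]

lemma fstCounts_jointCounts (x : Fin n → X) (z : Fin n → Z) :
    fstCounts (jointCounts x z) = counts x := by
  classical
  funext c
  have h := counts_map (fun i => (x i, z i)) Prod.fst c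
  rw [show (Prod.fst ∘ fun i => (x i, z i)) = x from rfl] at h
  rw [h, fstCounts]
  refine Finset.sum_nbij' (fun a => (c, a)) Prod.snd ?_ ?_ ?_ ?_ ?_ <;> simp [jointCounts]

/-- The probability `P(z|x)` of every pair with joint letter counts `J`. -/
def countsProb (P : X → Z → ℝ) (J : X × Z → ℕ) : ℝ :=
  ∏ a, P a.1 a.2 ^ J a

lemma seqProb_eq_countsProb (P : X → Z → ℝ) (x : Fin n → X) (z : Fin n → Z) :
    seqProb P x z = countsProb P (jointCounts x z) :=
  prod_comp_counts (fun i => (x i, z i)) fun a => P a.1 a.2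

lemma countsProb_nonneg {P : X → Z → ℝ} (hP : P ∈ channels X Z) (J : X × Z → ℕ) :
    0 ≤ countsProb P J :=
  Finset.prod_nonneg fun a _ => pow_nonneg ((hP a.1).1 a.2) _

open Classical in
/-- The members of `T` that have joint letter counts `J` with `z`. -/
def conditionalType (T : Finset (Fin n → X)) (J : X × Z → ℕ) (z : Fin n → Z) :
    Finset (Fin n → X) :=
  T.filter fun x => jointCounts x z = J

lemma conditionalType_subset (T : Finset (Fin n → X)) (J : X × Z → ℕ) (z : Fin n → Z) :
    conditionalType T J z ⊆ T := Finset.filter_subset _ _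

lemma mem_conditionalType {T : Finset (Fin n → X)} {J : X × Z → ℕ} {z : Fin n → Z}
    {x : Fin n → X} : x ∈ conditionalType T J z ↔ x ∈ T ∧ jointCounts x z = J := by
  simp [conditionalType]

open Classical in
/-- The joint letter counts that occur when `x` ranges over `T`. -/
def jointTypes (Z : Type*) [Fintype Z] (T : Finset (Fin n → X)) : Finset (X × Z → ℕ) :=
  (T ×ˢ (Finset.univ : Finset (Fin n → Z))).image fun p => jointCounts p.1 p.2

lemma mem_jointTypes {T : Finset (Fin n → X)} {J : X × Z → ℕ} :
    J ∈ jointTypes Z T ↔ ∃ x ∈ T, ∃ z, jointCounts x z = J := by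
  simp [jointTypes]

/-- Summing over joint types thus costs only a polynomial factor. -/
lemma card_jointTypes_le (T : Finset (Fin n → X)) :
    (jointTypes Z T).card ≤ (n + 1) ^ (Fintype.card X * Fintype.card Z) := by
  classical
  have h : jointTypes Z T ⊆ Fintype.piFinset fun _ : X × Z => Finset.range (n + 1) := by
    intro J hJ
    obtain ⟨x, _, z, rfl⟩ := mem_jointTypes.1 hJ
    simp only [Fintype.mem_piFinset, Finset.mem_range]
    exact fun a => Nat.lt_succ_of_le (counts_le _ _)
  refine (Finset.card_le_card h).trans ?_
  rw [Fintype.card_piFinset]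
  simp

lemma subcodeProb_eq_sum_hits {P : X → Z → ℝ} {T : Finset (Fin n → X)} (c : Fin M₂ → Fin n → X)
    (hc : ∀ b, c b ∈ T) (z : Fin n → Z) :
    subcodeProb P c z = 1 / M₂ *
      ∑ J ∈ jointTypes Z T, countsProb P J * hits (conditionalType T J z) c := by
  classical
  unfold subcodeProb hits
  congr 1
  simp only [Finset.mul_sum]
  rw [Finset.sum_comm]
  refine Finset.sum_congr rfl fun b _ => ?_
  rw [Finset.sum_eq_single (jointCounts (c b) z)]
  · rw [if_pos (mem_conditionalType.2 ⟨hc b, rfl⟩), mul_one, seqProb_eq_countsProb]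
  · intro J _ hJ
    rw [if_neg fun h => hJ (mem_conditionalType.1 h).2.symm, mul_zero]
  · exact fun h => absurd (mem_jointTypes.2 ⟨c b, hc b, z, rfl⟩) h

/-- For each `z` only the message `w = dec C z` survives in the sum over messages. -/
lemma avgCorrectProb_eq_expect (P : X → Z → ℝ) (PX : X → ℝ)
    (dec : (Fin M → Fin M₂ → Fin n → X) → (Fin n → Z) → Fin M) :
    avgCorrectProb P PX dec = 1 / M * ∑ z, 𝔼 C ∈ arrays M M₂ (typeClass n PX),
      subcodeProb P (C (dec C z)) z := by
  classical
  rw [← Finset.expect_sum_comm, Finset.mul_expect, avgCorrectProb, Finset.expect_eq_sum_div_card]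
  change _ / ((arrays M M₂ (typeClass n PX)).card : ℝ) = _
  congr 1
  refine Finset.sum_congr rfl fun C _ => ?_
  rw [correctProb, Finset.sum_comm]
  simp

/-- A pair `(z, x)` is determined by its sequence of letter pairs. -/
lemma sum_card_conditionalType_le (T : Finset (Fin n → X)) (J : X × Z → ℕ) :
    ∑ z, (conditionalType T J z).card ≤ (seqsWithCounts n J).card := by
  classical
  rw [← Finset.card_sigma]
  refine Finset.card_le_card_of_injOn (fun s i => (s.2 i, s.1 i)) ?_ ?_
  · rintro ⟨z, x⟩ h
    simp only [Finset.coe_sigma, Set.mem_sigma_iff, Finset.mem_coe, mem_conditionalType] at h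
    exact mem_seqsWithCounts.2 h.2.2
  · rintro ⟨z, x⟩ _ ⟨z', x'⟩ _ h
    have h1 : z = z' := funext fun i => congrArg Prod.snd (congrFun h i)
    have h2 : x = x' := funext fun i => congrArg Prod.fst (congrFun h i)
    subst h1 h2; rfl

lemma conditionalType_eq_empty {T : Finset (Fin n → X)} {J : X × Z → ℕ} {z : Fin n → Z}
    (h : z ∉ seqsWithCounts n (sndCounts J)) : conditionalType T J z = ∅ := by
  rw [Finset.eq_empty_iff_forall_notMem]
  intro x hx
  refine h (mem_seqsWithCounts.2 ?_)
  rw [← (mem_conditionalType.1 hx).2, sndCounts_jointCounts]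

lemma sum_frac_conditionalType_le (T : Finset (Fin n → X)) (J : X × Z → ℕ) :
    ∑ z, frac T (conditionalType T J z) ≤ (seqsWithCounts n J).card / T.card := by
  simp only [frac_eq_card_div (conditionalType_subset T J _), ← Finset.sum_div]
  gcongr
  exact_mod_cast sum_card_conditionalType_le T J

/-- Upper bound on the average probability of correct decoding. -/
theorem avgCorrectProb_le {P : X → Z → ℝ} (hP : P ∈ channels X Z) {PX : X → ℝ}
    (hT : (typeClass n PX).Nonempty) (hM : 0 < M) (hM₂ : 0 < M₂)
    (dec : (Fin M → Fin M₂ → Fin n → X) → (Fin n → Z) → Fin M) :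
    avgCorrectProb P PX dec ≤ ∑ J ∈ jointTypes Z (typeClass n PX), countsProb P J *
      min (((seqsWithCounts n J).card : ℝ) / (typeClass n PX).card)
        (((seqsWithCounts n (sndCounts J)).card : ℝ) * Real.log M / (M * M₂) +
          2 * (((seqsWithCounts n J).card : ℝ) / (typeClass n PX).card) / M) := by
  classical
  have hM' : (0 : ℝ) < M := by exact_mod_cast hM
  have hM₂' : (0 : ℝ) < M₂ := by exact_mod_cast hM₂
  set T := typeClass n PX
  have h1 : avgCorrectProb P PX dec = ∑ J ∈ jointTypes Z T, countsProb P J *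
      ((∑ z, 𝔼 C ∈ arrays M M₂ T, hits (conditionalType T J z) (C (dec C z))) / (M * M₂)) := by
    rw [avgCorrectProb_eq_expect]
    have h2 : ∀ z, 𝔼 C ∈ arrays M M₂ T, subcodeProb P (C (dec C z)) z =
        1 / M₂ * ∑ J ∈ jointTypes Z T, countsProb P J *
          𝔼 C ∈ arrays M M₂ T, hits (conditionalType T J z) (C (dec C z)) := by
      intro z
      simp only [Finset.mul_expect]
      rw [← Finset.expect_sum_comm, Finset.mul_expect]
      refine Finset.expect_congr rfl fun C hC => ?_
      exact subcodeProb_eq_sum_hits _ (fun b => mem_arrays.1 hC _ b) z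
    simp only [T] at h2
    simp only [h2, ← Finset.mul_sum]
    rw [Finset.sum_comm]
    simp only [← Finset.mul_sum, T]
    rw [← mul_assoc, Finset.mul_sum]
    refine Finset.sum_congr rfl fun J _ => ?_
    field_simp
  rw [h1]
  refine Finset.sum_le_sum fun J _ => mul_le_mul_of_nonneg_left ?_ (countsProb_nonneg hP J)
  have hfrac := sum_frac_conditionalType_le T J
  -- The sum over all rows is the good bound when `I ≥ R₁`, the exponential moment when `I ≤ R₁`.
  refine le_min ?_ ?_
  · rw [div_le_iff₀ (by positivity)]
    refine (Finset.sum_le_sum fun z _ =>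
      expect_hits_selected_le_mul hT _ fun C => dec C z).trans ?_
    rw [← Finset.mul_sum, mul_comm]
    gcongr
  · rw [div_le_iff₀ (by positivity)]
    -- If the type of `z` is not the second marginal of `J` there are no hits at all, so `log M` is
    -- charged only for the `z` of that type.
    have h3 : ∀ z, 𝔼 C ∈ arrays M M₂ T, hits (conditionalType T J z) (C (dec C z)) ≤
        (if z ∈ seqsWithCounts n (sndCounts J) then Real.log M else 0) +
          2 * M₂ * frac T (conditionalType T J z) := by
      intro z
      split_ifs with h
      · refine (expect_hits_selected_le_log hT _ hM fun C => dec C z).trans ?_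
        linarith
      · rw [conditionalType_eq_empty h]
        simp [hits, frac]
    refine (Finset.sum_le_sum fun z _ => h3 z).trans ?_
    rw [Finset.sum_add_distrib, ← Finset.mul_sum, Finset.sum_ite_mem, Finset.univ_inter,
      Finset.sum_const, nsmul_eq_mul]
    have h4 : (((seqsWithCounts n (sndCounts J)).card : ℝ) * Real.log M / (M * M₂) +
          2 * ((seqsWithCounts n J).card / T.card : ℝ) / M) * (M * M₂) =
        (seqsWithCounts n (sndCounts J)).card * Real.log M +
          2 * M₂ * ((seqsWithCounts n J).card / T.card) := by
      field_simp
    rw [h4]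
    gcongr

lemma card_conditionalType_comp_perm {k : X → ℕ} (J : X × Z → ℕ) (z : Fin n → Z)
    (σ : Equiv.Perm (Fin n)) :
    (conditionalType (seqsWithCounts n k) J z).card ≤
      (conditionalType (seqsWithCounts n k) J (z ∘ σ)).card := by
  refine Finset.card_le_card_of_injOn (fun x => x ∘ σ) ?_ ?_
  · intro x hx
    have hx := mem_conditionalType.1 (Finset.mem_coe.1 hx)
    refine mem_conditionalType.2 ⟨mem_seqsWithCounts.2 ?_, ?_⟩
    · rw [counts_comp_perm]; exact mem_seqsWithCounts.1 hx.1
    · rw [← hx.2]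
      exact counts_comp_perm (fun i => (x i, z i)) σ
  · intro x _ y _ h
    exact σ.surjective.injective_comp_right h

lemma card_conditionalType_eq {k : X → ℕ} (J : X × Z → ℕ) {z z' : Fin n → Z}
    (h : counts z = counts z') :
    (conditionalType (seqsWithCounts n k) J z).card =
      (conditionalType (seqsWithCounts n k) J z').card := by
  obtain ⟨σ, rfl⟩ := exists_perm_of_counts_eq h
  obtain ⟨τ, hτ⟩ := exists_perm_of_counts_eq h.symm
  refine le_antisymm ?_ (card_conditionalType_comp_perm J z' σ)
  conv_rhs => rw [hτ]
  exact card_conditionalType_comp_perm J _ τ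

/-- All sequences of the same type have conditional types of the same size. -/
lemma card_mul_card_conditionalType {J : X × Z → ℕ} {z : Fin n → Z}
    (hz : z ∈ seqsWithCounts n (sndCounts J)) :
    (seqsWithCounts n (sndCounts J)).card *
      (conditionalType (seqsWithCounts n (fstCounts J)) J z).card =
        (seqsWithCounts n J).card := by
  classical
  rw [Finset.card_eq_sum_card_fiberwise (s := seqsWithCounts n J)
    (f := fun y i => (y i).2) (t := seqsWithCounts n (sndCounts J)), ← smul_eq_mul,
    ← Finset.sum_const]
  · refine Finset.sum_congr rfl fun z' hz' => ?_
    rw [card_conditionalType_eq J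
      ((mem_seqsWithCounts.1 hz).trans (mem_seqsWithCounts.1 hz').symm)]
    refine Finset.card_bij (fun x _ i => (x i, z' i)) ?_ ?_ ?_
    · intro x hx
      simp only [Finset.mem_filter, mem_seqsWithCounts]
      exact ⟨(mem_conditionalType.1 hx).2, trivial⟩
    · intro x _ y _ h
      exact funext fun i => congrArg Prod.fst (congrFun h i)
    · intro y hy
      simp only [Finset.mem_filter, mem_seqsWithCounts] at hy
      have h1 : (fun i => ((y i).1, z' i)) = y := by
        funext i
        rw [← hy.2]
      have h2 : jointCounts (fun i => (y i).1) z' = J := by rw [jointCounts, h1, hy.1]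
      refine ⟨fun i => (y i).1, mem_conditionalType.2 ⟨mem_seqsWithCounts.2 ?_, h2⟩, h1⟩
      rw [← h2, fstCounts_jointCounts]
  · intro y hy
    refine mem_seqsWithCounts.2 ?_
    rw [← mem_seqsWithCounts.1 hy]
    exact (sndCounts_jointCounts (fun i => (y i).1) (fun i => (y i).2)).symm

lemma subcodeProb_nonneg {P : X → Z → ℝ} (hP : P ∈ channels X Z) (c : Fin M₂ → Fin n → X)
    (z : Fin n → Z) : 0 ≤ subcodeProb P c z :=
  mul_nonneg (by positivity) <| Finset.sum_nonneg fun b _ =>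
    Finset.prod_nonneg fun i _ => (hP _).1 _

/-- Lower bound on the average probability of correct decoding. -/
theorem le_avgCorrectProb {P : X → Z → ℝ} (hP : P ∈ channels X Z) {PX : X → ℝ}
    (hT : (typeClass n PX).Nonempty) (hM : 0 < M) (hM₂ : 0 < M₂)
    {dec : (Fin M → Fin M₂ → Fin n → X) → (Fin n → Z) → Fin M}
    (hdec : ∀ C, IsOptimalDecoder P C (dec C)) {J : X × Z → ℕ}
    (hJ : typeClass n PX = seqsWithCounts n (fstCounts J))
    (hne : (seqsWithCounts n (sndCounts J)).Nonempty) :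
    countsProb P J * max (((seqsWithCounts n J).card : ℝ) / (typeClass n PX).card / M)
      (1 / 2 * min (((seqsWithCounts n (sndCounts J)).card : ℝ) / (M * M₂))
        (((seqsWithCounts n J).card : ℝ) / (typeClass n PX).card)) ≤ avgCorrectProb P PX dec := by
  classical
  have hM' : (0 : ℝ) < M := by exact_mod_cast hM
  have hM₂' : (0 : ℝ) < M₂ := by exact_mod_cast hM₂
  set T := typeClass n PX
  set N : ℝ := ((seqsWithCounts n (sndCounts J)).card : ℝ) with hN
  have hN0 : 0 < N := by rw [hN]; exact_mod_cast hne.card_pos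
  set a : ℝ := ((seqsWithCounts n J).card : ℝ) / T.card with ha
  have hp := countsProb_nonneg hP J
  have hfrac : ∀ z ∈ seqsWithCounts n (sndCounts J), frac T (conditionalType T J z) = a / N := by
    intro z hz
    have h1 := card_mul_card_conditionalType hz
    rw [frac_eq_card_div (conditionalType_subset _ _ _), ha, ← h1, ← hJ]
    push_cast
    rw [← hN]
    field_simp
  have hsub : ∀ C ∈ arrays M M₂ T, ∀ w z,
      countsProb P J / M₂ * hits (conditionalType T J z) (C w) ≤ subcodeProb P (C w) z := by
    intro C hC w z
    rw [subcodeProb, hits, div_mul_eq_mul_div, ← mul_one_div, mul_comm, Finset.mul_sum]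
    refine mul_le_mul_of_nonneg_left (Finset.sum_le_sum fun b _ => ?_) (by positivity)
    split_ifs with h
    · rw [mul_one, seqProb_eq_countsProb, (mem_conditionalType.1 h).2]
    · rw [mul_zero]
      exact Finset.prod_nonneg fun i _ => (hP _).1 _
  -- An optimal decoder is at least as good as the constant guess `w = 0`, and as naming a row with
  -- a codeword of joint type `J` whenever there is one.
  have hlow : ∀ z ∈ seqsWithCounts n (sndCounts J),
      countsProb P J / M₂ * max (M₂ * (a / N)) (1 / 2 * min 1 (M * M₂ * (a / N))) ≤
        𝔼 C ∈ arrays M M₂ T, subcodeProb P (C (dec C z)) z := by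
    intro z hz
    rw [← hfrac z hz]
    rcases max_choice (M₂ * frac T (conditionalType T J z))
      (1 / 2 * min 1 (M * M₂ * frac T (conditionalType T J z))) with h | h
    · rw [h, ← expect_hits hT _ (⟨0, hM⟩ : Fin M), Finset.mul_expect]
      exact Finset.expect_le_expect fun C hC => (hsub C hC _ z).trans (hdec C z _)
    · rw [h]
      refine (mul_le_mul_of_nonneg_left (le_expect_exists_mem hT _) (by positivity)).trans ?_
      rw [Finset.mul_expect]
      refine Finset.expect_le_expect fun C hC => ?_
      split_ifs with h'
      · obtain ⟨w, b, hwb⟩ := h'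
        refine le_trans ?_ ((hsub C hC w z).trans (hdec C z w))
        exact mul_le_mul_of_nonneg_left (one_le_hits hwb) (by positivity)
      · rw [mul_zero]; exact subcodeProb_nonneg hP _ _
  rw [avgCorrectProb_eq_expect]
  have hsum : N * (countsProb P J / M₂ *
      max (M₂ * (a / N)) (1 / 2 * min 1 (M * M₂ * (a / N)))) ≤
      ∑ z, 𝔼 C ∈ arrays M M₂ T, subcodeProb P (C (dec C z)) z := by
    rw [hN, ← nsmul_eq_mul, ← Finset.sum_const]
    refine (Finset.sum_le_sum hlow).trans ?_
    exact Finset.sum_le_sum_of_subset_of_nonneg (Finset.subset_univ _) fun z _ _ =>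
      Finset.expect_nonneg fun C _ => subcodeProb_nonneg hP _ _
  refine le_trans (le_of_eq ?_) (mul_le_mul_of_nonneg_left hsum (by positivity))
  have hc : 0 ≤ N / (M * M₂) := by positivity
  have e1 : a / M = N / (M * M₂) * (M₂ * (a / N)) := by field_simp
  have e2 : (1 : ℝ) / 2 * min (N / (M * M₂)) a =
      N / (M * M₂) * (1 / 2 * min 1 (M * M₂ * (a / N))) := by
    rw [mul_left_comm, mul_min_of_nonneg _ _ hc]
    congr 2
    · ring
    · field_simp
  rw [e1, e2, ← mul_max_of_nonneg _ _ hc]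
  field_simp

end JointTypes


/-! ### The channel of a joint type -/

section ChannelOfCounts

variable {n : ℕ} {PX : X → ℝ} {J : X × Z → ℕ}

/-- The conditional empirical distribution of `J`; the rows of letters that do not occur are
taken from `W`. -/
def channelOfCounts (W : X → Z → ℝ) (J : X × Z → ℕ) (x : X) (z : Z) : ℝ :=
  if fstCounts J x = 0 then W x z else J (x, z) / fstCounts J x

lemma eq_zero_of_fstCounts_eq_zero {x : X} (h : fstCounts J x = 0) (z : Z) : J (x, z) = 0 :=
  Finset.sum_eq_zero_iff.1 h z (Finset.mem_univ z)

lemma channelOfCounts_mem {W : X → Z → ℝ} (hW : W ∈ channels X Z) (J : X × Z → ℕ) :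
    channelOfCounts W J ∈ channels X Z := by
  intro x
  by_cases h : fstCounts J x = 0
  · have : channelOfCounts W J x = W x := by funext z; simp [channelOfCounts, h]
    rw [this]; exact hW x
  · have h' : (fstCounts J x : ℝ) ≠ 0 := by exact_mod_cast h
    refine ⟨fun z => ?_, ?_⟩
    · simp only [channelOfCounts, if_neg h]; positivity
    · simp only [channelOfCounts, if_neg h, ← Finset.sum_div]
      rw [div_eq_one_iff_eq h', fstCounts]
      push_cast; rfl

lemma pos_of_countsProb_pos {P : X → Z → ℝ} (hp : 0 < countsProb P J) {x : X} {z : Z}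
    (h : J (x, z) ≠ 0) : P x z ≠ 0 := by
  intro h0
  refine hp.ne' (Finset.prod_eq_zero (Finset.mem_univ (x, z)) ?_)
  simp [h0, h]

/-- A letter of positive weight occurs, so its row is the empirical one, and `J` vanishes wherever
`P` does because `countsProb P J` is positive. -/
lemma channelOfCounts_mem_dominated {P W : X → Z → ℝ} (hW : W ∈ channels X Z) (hn : 0 < n)
    (hJ : ∀ x, (fstCounts J x : ℝ) = n * PX x) (hp : 0 < countsProb P J) :
    channelOfCounts W J ∈ dominated PX P := by
  refine ⟨channelOfCounts_mem hW J, fun x z h0 h1 => ?_⟩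
  have h2 : fstCounts J x ≠ 0 := by
    intro h
    have h3 := hJ x
    rw [h, Nat.cast_zero] at h3
    have : (0 : ℝ) < n * PX x := by positivity
    exact this.ne h3
  have h3 : J (x, z) = 0 := by
    by_contra h; exact pos_of_countsProb_pos hp h h1
  simp [channelOfCounts, h2, h3]

lemma weight_eq_zero (hn : 0 < n) (hJ : ∀ x, (fstCounts J x : ℝ) = n * PX x) {x : X}
    (h : fstCounts J x = 0) : PX x = 0 := by
  have h3 := hJ x
  rw [h, Nat.cast_zero] at h3
  have hn' : (n : ℝ) ≠ 0 := by positivity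
  exact (mul_eq_zero.1 h3.symm).resolve_left hn'

lemma mul_weight_mul_log_channelOfCounts (W : X → Z → ℝ) (hn : 0 < n)
    (hJ : ∀ x, (fstCounts J x : ℝ) = n * PX x) (x : X) (z : Z) :
    n * (PX x * (channelOfCounts W J x z * Real.log (channelOfCounts W J x z))) =
      J (x, z) * Real.log (J (x, z)) - J (x, z) * Real.log (fstCounts J x) := by
  by_cases h : fstCounts J x = 0
  · simp [weight_eq_zero hn hJ h, eq_zero_of_fstCounts_eq_zero h]
  · have h' : (fstCounts J x : ℝ) ≠ 0 := by exact_mod_cast h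
    simp only [channelOfCounts, if_neg h]
    by_cases h2 : J (x, z) = 0
    · simp [h2]
    · have h2' : (J (x, z) : ℝ) ≠ 0 := by exact_mod_cast h2
      rw [← mul_assoc, ← hJ, Real.log_div h2' h']
      field_simp

lemma mul_weight_mul_channelOfCounts (W : X → Z → ℝ) (hn : 0 < n)
    (hJ : ∀ x, (fstCounts J x : ℝ) = n * PX x) (x : X) (z : Z) :
    n * (PX x * channelOfCounts W J x z) = J (x, z) := by
  by_cases h : fstCounts J x = 0
  · simp [weight_eq_zero hn hJ h, eq_zero_of_fstCounts_eq_zero h]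
  · have h' : (fstCounts J x : ℝ) ≠ 0 := by exact_mod_cast h
    simp only [channelOfCounts, if_neg h]
    rw [← mul_assoc, ← hJ]
    field_simp

lemma sum_mul_log_eq : ∑ x, ∑ z, ((J (x, z) : ℝ) * Real.log (J (x, z)) -
      J (x, z) * Real.log (fstCounts J x)) = sumMulLog J - sumMulLog (fstCounts J) := by
  simp only [Finset.sum_sub_distrib]
  rw [sumMulLog, sumMulLog, Fintype.sum_prod_type]
  congr 1
  refine Finset.sum_congr rfl fun x _ => ?_
  rw [← Finset.sum_mul, fstCounts]
  push_cast; rfl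

lemma log_countsProb {P : X → Z → ℝ} (hp : 0 < countsProb P J) :
    Real.log (countsProb P J) = ∑ x, ∑ z, (J (x, z) : ℝ) * Real.log (P x z) := by
  rw [countsProb, Real.log_prod, Fintype.sum_prod_type]
  · simp only [Real.log_pow]
  · intro a ha h
    exact hp.ne' (Finset.prod_eq_zero ha h)

lemma mul_realDiv_channelOfCounts {P : X → Z → ℝ} (W : X → Z → ℝ) (hn : 0 < n)
    (hJ : ∀ x, (fstCounts J x : ℝ) = n * PX x) (hp : 0 < countsProb P J) :
    n * realDiv PX P (channelOfCounts W J) =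
      sumMulLog J - sumMulLog (fstCounts J) - Real.log (countsProb P J) := by
  rw [← sum_mul_log_eq, log_countsProb hp, ← Finset.sum_sub_distrib]
  simp only [realDiv, Finset.mul_sum, ← Finset.sum_sub_distrib]
  refine Finset.sum_congr rfl fun x _ => Finset.sum_congr rfl fun z _ => ?_
  rw [← mul_weight_mul_log_channelOfCounts W hn hJ]
  rw [← mul_weight_mul_channelOfCounts W hn hJ x z]
  ring

lemma mul_outputDist_channelOfCounts (W : X → Z → ℝ) (hn : 0 < n)
    (hJ : ∀ x, (fstCounts J x : ℝ) = n * PX x) (z : Z) :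
    n * outputDist PX (channelOfCounts W J) z = sndCounts J z := by
  rw [outputDist, Finset.mul_sum, sndCounts]
  push_cast
  exact Finset.sum_congr rfl fun x _ => mul_weight_mul_channelOfCounts W hn hJ x z

lemma sum_fstCounts (hPX : PX ∈ stdSimplex ℝ X)
    (hJ : ∀ x, (fstCounts J x : ℝ) = n * PX x) : ∑ x, fstCounts J x = n := by
  have h : ((∑ x, fstCounts J x : ℕ) : ℝ) = n := by
    push_cast
    simp only [hJ, ← Finset.mul_sum, hPX.2, mul_one]
  exact_mod_cast h

lemma sum_counts_eq (hPX : PX ∈ stdSimplex ℝ X)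
    (hJ : ∀ x, (fstCounts J x : ℝ) = n * PX x) : ∑ a, J a = n := by
  rw [← sum_fstCounts hPX hJ, Fintype.sum_prod_type]; rfl

lemma sum_sndCounts (hPX : PX ∈ stdSimplex ℝ X)
    (hJ : ∀ x, (fstCounts J x : ℝ) = n * PX x) : ∑ z, sndCounts J z = n := by
  rw [← sum_counts_eq hPX hJ, Fintype.sum_prod_type_right]; rfl

lemma mul_realInfo_channelOfCounts (hPX : PX ∈ stdSimplex ℝ X) (W : X → Z → ℝ) (hn : 0 < n)
    (hJ : ∀ x, (fstCounts J x : ℝ) = n * PX x) :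
    n * realInfo PX (channelOfCounts W J) =
      sumMulLog J - sumMulLog (fstCounts J) - sumMulLog (sndCounts J) + n * Real.log n := by
  have hn' : (n : ℝ) ≠ 0 := by positivity
  have h1 : ∀ z, n * (outputDist PX (channelOfCounts W J) z *
      Real.log (outputDist PX (channelOfCounts W J) z)) =
      sndCounts J z * Real.log (sndCounts J z) - sndCounts J z * Real.log n := by
    intro z
    rw [← mul_outputDist_channelOfCounts W hn hJ z]
    by_cases h : outputDist PX (channelOfCounts W J) z = 0
    · simp [h]
    · rw [Real.log_mul hn' h]; ring
  have h2 : (∑ z, (sndCounts J z : ℝ)) = n := by exact_mod_cast sum_sndCounts hPX hJ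
  rw [← sum_mul_log_eq, realInfo, mul_sub]
  simp only [Finset.mul_sum, mul_weight_mul_log_channelOfCounts W hn hJ, h1]
  rw [Finset.sum_sub_distrib (s := (Finset.univ : Finset Z)) (fun z => _) (fun z => _),
    ← Finset.sum_mul, h2, sumMulLog]
  ring

/-- The logarithm of the subexponential factors in the estimates of type class sizes. -/
def typeError (X Z : Type*) [Fintype X] [Fintype Z] (n : ℕ) : ℝ :=
  (Fintype.card X * Fintype.card Z + Fintype.card X + Fintype.card Z + 3) *
    (1 + Real.log (n + 1))

lemma card_seqsWithCounts_pos {A : Type*} [Fintype A] {k : A → ℕ} (hk : ∑ a, k a = n) :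
    (0 : ℝ) < (seqsWithCounts n k).card := by
  obtain ⟨f, hf⟩ := exists_counts_eq hk
  exact_mod_cast Finset.card_pos.2 ⟨f, mem_seqsWithCounts.2 hf⟩

/-- For fixed `x` the ratio counts the `z` with joint type `J`, so the product is the probability
that the channel output has this joint type with `x`. The identity for `n D` is exact; the error
comes from the two cardinalities alone. -/
lemma abs_log_countsProb_mul_ratio_le (hPX : PX ∈ stdSimplex ℝ X) {P : X → Z → ℝ}
    (W : X → Z → ℝ) (hn : 0 < n) (hJ : ∀ x, (fstCounts J x : ℝ) = n * PX x)
    (hp : 0 < countsProb P J) :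
    |Real.log (countsProb P J * ((seqsWithCounts n J).card / (seqsWithCounts n (fstCounts J)).card))
      + n * realDiv PX P (channelOfCounts W J)| ≤ typeError X Z n := by
  have hs1 := sum_counts_eq hPX hJ
  have hs2 := sum_fstCounts hPX hJ
  have h1 := card_seqsWithCounts_pos hs1
  have h2 := card_seqsWithCounts_pos hs2
  rw [Real.log_mul hp.ne' (by positivity), Real.log_div h1.ne' h2.ne',
    mul_realDiv_channelOfCounts W hn hJ hp]
  have h3 := abs_log_card_seqsWithCounts_sub_le hs1
  have h4 := abs_log_card_seqsWithCounts_sub_le hs2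
  have h0 : 0 ≤ Real.log ((n : ℝ) + 1) :=
    Real.log_nonneg (by linarith [Nat.cast_nonneg (α := ℝ) n])
  have h5 : 0 ≤ ((Fintype.card Z : ℝ) + 1) * (1 + Real.log (n + 1)) := by positivity
  rw [Fintype.card_prod] at h3
  push_cast at h3
  rw [typeError]
  rw [abs_le] at h3 h4 ⊢
  constructor <;> linarith [h3.1, h3.2, h4.1, h4.2]

/-- `P(z|x)` is `exp(-n(D + H(Z|X)))` exactly and there are about `exp(n H(Z))` sequences `z`, which
leaves the exponent `D - I`. -/
lemma abs_log_countsProb_mul_card_le (hPX : PX ∈ stdSimplex ℝ X) {P : X → Z → ℝ}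
    (W : X → Z → ℝ) (hn : 0 < n) (hJ : ∀ x, (fstCounts J x : ℝ) = n * PX x)
    (hp : 0 < countsProb P J) :
    |Real.log (countsProb P J * (seqsWithCounts n (sndCounts J)).card)
      + n * (realDiv PX P (channelOfCounts W J) - realInfo PX (channelOfCounts W J))| ≤
      typeError X Z n := by
  have hs := sum_sndCounts hPX hJ
  have h1 := card_seqsWithCounts_pos hs
  rw [Real.log_mul hp.ne' h1.ne', mul_sub, mul_realDiv_channelOfCounts W hn hJ hp,
    mul_realInfo_channelOfCounts hPX W hn hJ]
  have h3 := abs_log_card_seqsWithCounts_sub_le hs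
  have h0 : 0 ≤ Real.log ((n : ℝ) + 1) :=
    Real.log_nonneg (by linarith [Nat.cast_nonneg (α := ℝ) n])
  have h5 : 0 ≤ ((Fintype.card X : ℝ) * Fintype.card Z + Fintype.card X + 2) *
    (1 + Real.log (n + 1)) := by positivity
  rw [typeError]
  rw [abs_le] at h3 ⊢
  constructor <;> linarith [h3.1, h3.2]

end ChannelOfCounts

/-! ### Single-letter bounds at a fixed block length -/

lemma typeClass_eq_seqsWithCounts {n : ℕ} {PX : X → ℝ} {k : X → ℕ} (hn : 0 < n)
    (hk : ∀ x, (k x : ℝ) = n * PX x) : typeClass n PX = seqsWithCounts n k := by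
  classical
  have hn' : (n : ℝ) ≠ 0 := by positivity
  ext x
  rw [mem_seqsWithCounts, typeClass, Finset.mem_filter]
  simp only [Finset.mem_univ, true_and]
  rw [funext_iff]
  refine forall_congr' fun a => ?_
  change ((counts x a : ℕ) : ℝ) / n = PX a ↔ counts x a = k a
  rw [div_eq_iff hn', mul_comm, ← hk, Nat.cast_inj]

lemma counts_eq_of_mem_typeClass {n : ℕ} {PX : X → ℝ} {x : Fin n → X} (hn : 0 < n)
    (hx : x ∈ typeClass n PX) (a : X) : (counts x a : ℝ) = n * PX a := by
  classical
  have hn' : (n : ℝ) ≠ 0 := by positivity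
  have h := (Finset.mem_filter.1 hx).2 a
  change ((counts x a : ℕ) : ℝ) / n = PX a at h
  rw [← h]
  field_simp

lemma pos_of_typeClass_nonempty {n : ℕ} {PX : X → ℝ} (hPX : PX ∈ stdSimplex ℝ X)
    (hT : (typeClass n PX).Nonempty) : 0 < n := by
  classical
  rcases Nat.eq_zero_or_pos n with rfl | h
  · obtain ⟨x, hx⟩ := hT
    have h : ∀ a, PX a = 0 := fun a => by
      have := (Finset.mem_filter.1 hx).2 a
      simpa using this.symm
    have h1 := hPX.2
    simp [h] at h1
  · exact h

lemma exp_mul_log_div {n M : ℕ} (hn : 0 < n) (hM : 0 < M) :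
    Real.exp (n * (Real.log M / n)) = M := by
  have hn' : (n : ℝ) ≠ 0 := by positivity
  rw [mul_div_cancel₀ _ hn', Real.exp_log (by exact_mod_cast hM)]

/-- With `r₁ = log M / n` and `r₂ = log M₂ / n`, an upper bound in terms of `rateObjective`. -/
lemma countsProb_mul_min_le {n M M₂ : ℕ} {PX : X → ℝ} {J : X × Z → ℕ}
    (hPX : PX ∈ stdSimplex ℝ X) {P : X → Z → ℝ} (W : X → Z → ℝ) (hn : 0 < n) (hM : 0 < M)
    (hM₂ : 0 < M₂) (hJ : ∀ x, (fstCounts J x : ℝ) = n * PX x) (hp : 0 < countsProb P J) :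
    countsProb P J *
      min (((seqsWithCounts n J).card : ℝ) / (typeClass n PX).card)
        (((seqsWithCounts n (sndCounts J)).card : ℝ) * Real.log M / (M * M₂) +
          2 * (((seqsWithCounts n J).card : ℝ) / (typeClass n PX).card) / M) ≤
      (Real.log M + 2) * Real.exp (typeError X Z n -
        n * rateObjective PX P (Real.log M / n + Real.log M₂ / n) (Real.log M / n)
          (channelOfCounts W J)) := by
  have hn' : (0 : ℝ) < n := by exact_mod_cast hn
  have hM' : (0 : ℝ) < M := by exact_mod_cast hM
  have hM₂' : (0 : ℝ) < M₂ := by exact_mod_cast hM₂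
  rw [typeClass_eq_seqsWithCounts hn hJ]
  have h1 := card_seqsWithCounts_pos (sum_counts_eq hPX hJ)
  have h2 := card_seqsWithCounts_pos (sum_fstCounts hPX hJ)
  have h3 := card_seqsWithCounts_pos (sum_sndCounts hPX hJ)
  have ha := abs_log_countsProb_mul_ratio_le hPX W hn hJ hp
  have hN := abs_log_countsProb_mul_card_le hPX W hn hJ hp
  set a : ℝ := ((seqsWithCounts n J).card : ℝ) / (seqsWithCounts n (fstCounts J)).card
  set N : ℝ := ((seqsWithCounts n (sndCounts J)).card : ℝ)
  set p := countsProb P J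
  set D := realDiv PX P (channelOfCounts W J) with hD
  set I := realInfo PX (channelOfCounts W J) with hI
  set δ := typeError X Z n
  have ha0 : 0 < a := by positivity
  have hlogM : 0 ≤ Real.log M := Real.log_nonneg (by exact_mod_cast hM)
  have eM := exp_mul_log_div hn hM
  have eM₂ := exp_mul_log_div hn hM₂
  set r₁ := Real.log M / n
  set r₂ := Real.log M₂ / n
  have ha' : p * a ≤ Real.exp (δ - n * D) := by
    rw [← Real.exp_log (show 0 < p * a by positivity), Real.exp_le_exp]
    linarith [(abs_le.1 ha).2]
  have hN' : p * N ≤ Real.exp (δ - n * (D - I)) := by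
    rw [← Real.exp_log (show 0 < p * N by positivity), Real.exp_le_exp]
    linarith [(abs_le.1 hN).2]
  rw [rateObjective, ← hD, ← hI]
  set m := min (r₁ + r₂ - I) r₁ with hm
  -- For `m ≤ 0` the first argument of the minimum suffices. For `m ≥ 0` the two terms of the second
  -- have exponents `D + r₁ + r₂ - I` and `D + r₁`, both at least `D + m`.
  rcases le_total m 0 with h | h
  · rw [max_eq_left h, add_zero]
    have h4 : p * min a (N * Real.log M / (M * M₂) + 2 * a / M) ≤ p * a :=
      mul_le_mul_of_nonneg_left (min_le_left _ _) hp.le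
    nlinarith [Real.exp_pos (δ - n * D)]
  · rw [max_eq_right h]
    have hm1 : m ≤ r₁ + r₂ - I := min_le_left _ _
    have hm2 : m ≤ r₁ := min_le_right _ _
    have h4 : p * min a (N * Real.log M / (M * M₂) + 2 * a / M) ≤
        Real.log M * (p * N / (M * M₂)) + 2 * (p * a / M) := by
      refine (mul_le_mul_of_nonneg_left (min_le_right _ _) hp.le).trans (le_of_eq ?_)
      ring
    have h5 : p * N / (M * M₂) ≤ Real.exp (δ - n * (D + m)) := by
      rw [div_le_iff₀ (by positivity), ← eM, ← eM₂, ← Real.exp_add, ← Real.exp_add]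
      refine hN'.trans (Real.exp_le_exp.2 ?_)
      nlinarith
    have h6 : p * a / M ≤ Real.exp (δ - n * (D + m)) := by
      rw [div_le_iff₀ hM', ← eM, ← Real.exp_add]
      refine ha'.trans (Real.exp_le_exp.2 ?_)
      nlinarith
    nlinarith

/-- With `r₁ = log M / n` and `r₂ = log M₂ / n`, a lower bound in terms of `rateObjective`. -/
lemma le_countsProb_mul_max {n M M₂ : ℕ} {PX : X → ℝ} {J : X × Z → ℕ}
    (hPX : PX ∈ stdSimplex ℝ X) {P : X → Z → ℝ} (W : X → Z → ℝ) (hn : 0 < n) (hM : 0 < M)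
    (hM₂ : 0 < M₂) (hJ : ∀ x, (fstCounts J x : ℝ) = n * PX x) (hp : 0 < countsProb P J) :
    1 / 2 * Real.exp (-typeError X Z n -
        n * rateObjective PX P (Real.log M / n + Real.log M₂ / n) (Real.log M / n)
          (channelOfCounts W J)) ≤
    countsProb P J * max (((seqsWithCounts n J).card : ℝ) / (typeClass n PX).card / M)
      (1 / 2 * min (((seqsWithCounts n (sndCounts J)).card : ℝ) / (M * M₂))
        (((seqsWithCounts n J).card : ℝ) / (typeClass n PX).card)) := by
  have hn' : (0 : ℝ) < n := by exact_mod_cast hn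
  have hM' : (0 : ℝ) < M := by exact_mod_cast hM
  have hM₂' : (0 : ℝ) < M₂ := by exact_mod_cast hM₂
  rw [typeClass_eq_seqsWithCounts hn hJ]
  have h1 := card_seqsWithCounts_pos (sum_counts_eq hPX hJ)
  have h2 := card_seqsWithCounts_pos (sum_fstCounts hPX hJ)
  have h3 := card_seqsWithCounts_pos (sum_sndCounts hPX hJ)
  have ha := abs_log_countsProb_mul_ratio_le hPX W hn hJ hp
  have hN := abs_log_countsProb_mul_card_le hPX W hn hJ hp
  set a : ℝ := ((seqsWithCounts n J).card : ℝ) / (seqsWithCounts n (fstCounts J)).card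
  set N : ℝ := ((seqsWithCounts n (sndCounts J)).card : ℝ)
  set p := countsProb P J
  set D := realDiv PX P (channelOfCounts W J) with hD
  set I := realInfo PX (channelOfCounts W J) with hI
  set δ := typeError X Z n
  have ha0 : 0 < a := by positivity
  have hlogM : 0 ≤ Real.log M := Real.log_nonneg (by exact_mod_cast hM)
  have eM := exp_mul_log_div hn hM
  have eM₂ := exp_mul_log_div hn hM₂
  have hr₁ : 0 ≤ Real.log M / n := by positivity
  set r₁ := Real.log M / n
  set r₂ := Real.log M₂ / n
  have ha' : Real.exp (-δ - n * D) ≤ p * a := by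
    rw [← Real.exp_log (show 0 < p * a by positivity), Real.exp_le_exp]
    linarith [(abs_le.1 ha).1]
  have hN' : Real.exp (-δ - n * (D - I)) ≤ p * N := by
    rw [← Real.exp_log (show 0 < p * N by positivity), Real.exp_le_exp]
    linarith [(abs_le.1 hN).1]
  rw [rateObjective, ← hD, ← hI]
  -- If `I ≤ r₂`, the bound from a fixed row is used; otherwise the one from the existence of a hit,
  -- whose minimum yields the two arguments of `max 0 (r₁ + r₂ - I)`.
  rcases le_total r₁ (r₁ + r₂ - I) with h | h
  · rw [min_eq_right h, max_eq_right hr₁]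
    refine le_trans ?_ (mul_le_mul_of_nonneg_left (le_max_left _ _) hp.le)
    rw [← mul_div_assoc, le_div_iff₀ hM']
    nth_rewrite 1 [← eM]
    rw [mul_assoc, ← Real.exp_add,
      show -δ - n * (D + r₁) + n * r₁ = -δ - n * D by ring]
    linarith [Real.exp_pos (-δ - n * D)]
  · rw [min_eq_left h]
    refine le_trans ?_ (mul_le_mul_of_nonneg_left (le_max_right _ _) hp.le)
    rw [mul_left_comm p, mul_min_of_nonneg _ _ hp.le]
    refine mul_le_mul_of_nonneg_left (le_min ?_ ?_) (by norm_num)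
    · rw [← mul_div_assoc, le_div_iff₀ (by positivity), ← eM, ← eM₂, ← Real.exp_add,
        ← Real.exp_add]
      refine le_trans (Real.exp_le_exp.2 ?_) hN'
      nlinarith [le_max_right 0 (r₁ + r₂ - I)]
    · refine le_trans (Real.exp_le_exp.2 ?_) ha'
      nlinarith [le_max_left 0 (r₁ + r₂ - I)]

lemma abs_max_min_sub_le (a b a' b' : ℝ) :
    |max 0 (min a b) - max 0 (min a' b')| ≤ |a - a'| + |b - b'| := by
  refine (abs_max_sub_max_le_max 0 (min a b) 0 (min a' b')).trans ?_
  rw [sub_self, abs_zero, max_eq_right (abs_nonneg _)]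
  refine (abs_min_sub_min_le_max a b a' b').trans ?_
  exact max_le_add_of_nonneg (abs_nonneg _) (abs_nonneg _)

/-- The effect on `rateObjective` of replacing the limiting rates by those at block length
`n`. -/
def rateError (R₁ R₂ r₁ r₂ : ℝ) : ℝ := |r₁ + r₂ - R₁| + |r₁ - (R₁ - R₂)|

lemma abs_rateObjective_sub_le (PX : X → ℝ) (P Q : X → Z → ℝ) (R₁ R₂ r₁ r₂ : ℝ) :
    |rateObjective PX P (r₁ + r₂) r₁ Q - rateObjective PX P R₁ (R₁ - R₂) Q| ≤
      rateError R₁ R₂ r₁ r₂ := by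
  rw [rateObjective, rateObjective, rateError, add_sub_add_left_eq_sub]
  refine (abs_max_min_sub_le _ _ _ _).trans (le_of_eq ?_)
  congr 2
  ring

/-- Each joint type of positive probability gives a dominated channel, whose objective is at least
the minimum. The actual rates are exchanged for the limiting ones at the cost of `rateError`. -/
lemma avgCorrectProb_le_exp {n M M₂ : ℕ} {P : X → Z → ℝ} (hP : P ∈ channels X Z) {PX : X → ℝ}
    (hPX : PX ∈ stdSimplex ℝ X) (hT : (typeClass n PX).Nonempty) (hM : 0 < M) (hM₂ : 0 < M₂)
    {R₁ R₂ : ℝ} {Q : X → Z → ℝ}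
    (hmin : IsMinOn (rateObjective PX P R₁ (R₁ - R₂)) (dominated PX P) Q)
    (dec : (Fin M → Fin M₂ → Fin n → X) → (Fin n → Z) → Fin M) :
    avgCorrectProb P PX dec ≤ ((n : ℝ) + 1) ^ (Fintype.card X * Fintype.card Z) *
      ((Real.log M + 2) * Real.exp (typeError X Z n - n * (rateObjective PX P R₁ (R₁ - R₂) Q -
        rateError R₁ R₂ (Real.log M / n) (Real.log M₂ / n)))) := by
  have hn := pos_of_typeClass_nonempty hPX hT
  have hlogM : 0 ≤ Real.log M := Real.log_nonneg (by exact_mod_cast hM)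
  refine (avgCorrectProb_le hP hT hM hM₂ dec).trans ?_
  have hcard : ((jointTypes Z (typeClass n PX)).card : ℝ) ≤
      ((n : ℝ) + 1) ^ (Fintype.card X * Fintype.card Z) := by
    exact_mod_cast card_jointTypes_le (Z := Z) (typeClass n PX)
  refine le_trans ?_ (mul_le_mul_of_nonneg_right hcard (by positivity))
  refine (Finset.sum_le_card_nsmul _ _ _ fun J hJ => ?_).trans_eq (nsmul_eq_mul _ _)
  -- A joint type of probability zero may give a channel that is not dominated, but it contributes
  -- nothing.
  rcases (countsProb_nonneg hP J).eq_or_lt with hp | hp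
  · rw [← hp, zero_mul]; positivity
  obtain ⟨x, hx, z, rfl⟩ := mem_jointTypes.1 hJ
  have hJ' : ∀ a, (fstCounts (jointCounts x z) a : ℝ) = n * PX a := fun a => by
    rw [fstCounts_jointCounts]; exact counts_eq_of_mem_typeClass hn hx a
  refine (countsProb_mul_min_le hPX P hn hM hM₂ hJ' hp).trans ?_
  refine mul_le_mul_of_nonneg_left (Real.exp_le_exp.2 ?_) (by positivity)
  have h1 := hmin (channelOfCounts_mem_dominated hP hn hJ' hp)
  simp only [mem_ofPred_eq] at h1
  have h2 := (abs_le.1 (abs_rateObjective_sub_le PX P (channelOfCounts P (jointCounts x z)) R₁ R₂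
    (Real.log M / n) (Real.log M₂ / n))).1
  gcongr
  linarith

lemma exp_le_avgCorrectProb {n M M₂ : ℕ} {P : X → Z → ℝ} (hP : P ∈ channels X Z) {PX : X → ℝ}
    (hPX : PX ∈ stdSimplex ℝ X) (hT : (typeClass n PX).Nonempty) (hM : 0 < M) (hM₂ : 0 < M₂)
    (R₁ R₂ : ℝ) {dec : (Fin M → Fin M₂ → Fin n → X) → (Fin n → Z) → Fin M}
    (hdec : ∀ C, IsOptimalDecoder P C (dec C)) {J : X × Z → ℕ} (W : X → Z → ℝ)
    (hJ : ∀ x, (fstCounts J x : ℝ) = n * PX x) (hp : 0 < countsProb P J) :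
    1 / 2 * Real.exp (-typeError X Z n - n * (rateObjective PX P R₁ (R₁ - R₂)
      (channelOfCounts W J) + rateError R₁ R₂ (Real.log M / n) (Real.log M₂ / n))) ≤
      avgCorrectProb P PX dec := by
  have hn := pos_of_typeClass_nonempty hPX hT
  have h3 := card_seqsWithCounts_pos (sum_sndCounts hPX hJ)
  refine le_trans ?_ ((le_countsProb_mul_max hPX W hn hM hM₂ hJ hp).trans
    (le_avgCorrectProb hP hT hM hM₂ hdec (typeClass_eq_seqsWithCounts hn hJ)
      (Finset.card_pos.1 (by exact_mod_cast h3))))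
  refine mul_le_mul_of_nonneg_left (Real.exp_le_exp.2 ?_) (by norm_num)
  have h2 := (abs_le.1 (abs_rateObjective_sub_le PX P (channelOfCounts W J) R₁ R₂
    (Real.log M / n) (Real.log M₂ / n))).2
  gcongr
  linarith

/-! ### Approximation of a channel by joint types -/

open Classical in
/-- Integer rounding of `k x * Q x z` that preserves the row sums; the letter `z₀ x` absorbs the
rounding errors. -/
def roundCounts (k : X → ℕ) (z₀ : X → Z) (Q : X → Z → ℝ) (a : X × Z) : ℕ :=
  if a.2 = z₀ a.1 then k a.1 - ∑ z ∈ Finset.univ.erase (z₀ a.1), ⌊k a.1 * Q a.1 z⌋₊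
  else ⌊k a.1 * Q a.1 a.2⌋₊

-- This ensures that the natural subtraction in `roundCounts` does not truncate.
open Classical in
lemma sum_floor_le {Q : X → Z → ℝ} (hQ : Q ∈ channels X Z) (k : ℕ) (x : X) (z₀ : Z) :
    ((∑ z ∈ Finset.univ.erase z₀, ⌊k * Q x z⌋₊ : ℕ) : ℝ) ≤ k - k * Q x z₀ := by
  push_cast
  have h1 : ∑ z ∈ Finset.univ.erase z₀, k * Q x z = k - k * Q x z₀ := by
    have h2 := Finset.sum_erase_add Finset.univ (fun z => (k : ℝ) * Q x z) (Finset.mem_univ z₀)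
    rw [← Finset.mul_sum Finset.univ, (hQ x).2] at h2
    linarith
  rw [← h1]
  exact Finset.sum_le_sum fun z _ => Nat.floor_le (mul_nonneg (by positivity) ((hQ x).1 z))

lemma fstCounts_roundCounts {Q : X → Z → ℝ} (hQ : Q ∈ channels X Z) (k : X → ℕ) (z₀ : X → Z) :
    fstCounts (roundCounts k z₀ Q) = k := by
  classical
  funext x
  have h1 := sum_floor_le hQ (k x) x (z₀ x)
  have h2 : ∑ z ∈ Finset.univ.erase (z₀ x), ⌊k x * Q x z⌋₊ ≤ k x := by
    have h3 : (0 : ℝ) ≤ k x * Q x (z₀ x) := mul_nonneg (by positivity) ((hQ x).1 _)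
    have h4 := h1.trans (sub_le_self _ h3)
    exact_mod_cast h4
  rw [fstCounts, ← Finset.sum_erase_add _ _ (Finset.mem_univ (z₀ x))]
  have h4 : ∑ z ∈ Finset.univ.erase (z₀ x), roundCounts k z₀ Q (x, z) =
      ∑ z ∈ Finset.univ.erase (z₀ x), ⌊k x * Q x z⌋₊ := by
    refine Finset.sum_congr rfl fun z hz => ?_
    simp [roundCounts, Finset.ne_of_mem_erase hz]
  rw [h4]
  simp only [roundCounts, if_true]
  convert Nat.add_sub_cancel' h2

/-- The letter `z₀ x` collects at most `|Z| - 1` rounding errors, each at most `1`. -/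
lemma abs_roundCounts_sub_le {Q : X → Z → ℝ} (hQ : Q ∈ channels X Z) (k : X → ℕ) (z₀ : X → Z)
    (x : X) (z : Z) : |(roundCounts k z₀ Q (x, z) : ℝ) - k x * Q x z| ≤ Fintype.card Z := by
  classical
  have hfl : ∀ z, ⌊k x * Q x z⌋₊ ≤ k x * Q x z ∧ k x * Q x z - 1 ≤ (⌊k x * Q x z⌋₊ : ℝ) :=
    fun z => ⟨Nat.floor_le (mul_nonneg (by positivity) ((hQ x).1 z)),
      by linarith [Nat.lt_floor_add_one ((k x : ℝ) * Q x z)]⟩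
  have hZ : (1 : ℝ) ≤ Fintype.card Z := by
    exact_mod_cast Fintype.card_pos_iff.2 ⟨z⟩
  by_cases h : z = z₀ x
  · have h1 : (∑ z', (roundCounts k z₀ Q (x, z') : ℝ)) = k x := by
      exact_mod_cast congrFun (fstCounts_roundCounts hQ k z₀) x
    have h2 : ∑ z', (k x : ℝ) * Q x z' = k x := by rw [← Finset.mul_sum, (hQ x).2, mul_one]
    rw [← Finset.sum_erase_add _ _ (Finset.mem_univ z)] at h1 h2
    have h3 : ∀ z' ∈ Finset.univ.erase z,
        (roundCounts k z₀ Q (x, z') : ℝ) = ⌊k x * Q x z'⌋₊ := by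
      intro z' hz'
      have : z' ≠ z₀ x := h ▸ Finset.ne_of_mem_erase hz'
      simp [roundCounts, this]
    rw [Finset.sum_congr rfl h3] at h1
    have h4 : ∑ z' ∈ Finset.univ.erase z, (⌊k x * Q x z'⌋₊ : ℝ) ≤
        ∑ z' ∈ Finset.univ.erase z, (k x : ℝ) * Q x z' :=
      Finset.sum_le_sum fun z' _ => (hfl z').1
    have h5 : ∑ z' ∈ Finset.univ.erase z, ((k x : ℝ) * Q x z' - 1) ≤
        ∑ z' ∈ Finset.univ.erase z, (⌊k x * Q x z'⌋₊ : ℝ) :=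
      Finset.sum_le_sum fun z' _ => (hfl z').2
    rw [Finset.sum_sub_distrib, Finset.sum_const, nsmul_eq_mul, mul_one,
      Finset.card_erase_of_mem (Finset.mem_univ z), Finset.card_univ,
      Nat.cast_pred (Fintype.card_pos_iff.2 ⟨z⟩)] at h5
    rw [abs_le]
    constructor <;> linarith
  · simp only [roundCounts, if_neg h]
    rw [abs_le]
    constructor <;> linarith [(hfl z).1, (hfl z).2]

/-- Rounding down creates no mass where `Q` vanishes, and the surplus goes to `z₀ x`, where `Q` is
positive; so no mass falls on a zero of `P`. -/
lemma countsProb_roundCounts_pos {PX : X → ℝ} {P Q : X → Z → ℝ} (hP : P ∈ channels X Z)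
    (hQ : Q ∈ dominated PX P) {z₀ : X → Z} (hz₀ : ∀ x, 0 < Q x (z₀ x)) {k : X → ℕ} {n : ℕ}
    (hk : ∀ x, (k x : ℝ) = n * PX x) (hPX : ∀ x, 0 ≤ PX x) :
    0 < countsProb P (roundCounts k z₀ Q) := by
  refine Finset.prod_pos fun a _ => ?_
  by_cases h : roundCounts k z₀ Q a = 0
  · rw [h, pow_zero]; exact one_pos
  refine pow_pos (lt_of_le_of_ne ((hP a.1).1 a.2) (Ne.symm fun h0 => h ?_)) _
  by_cases hx : PX a.1 = 0
  · have h1 : k a.1 = 0 := by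
      have := hk a.1
      rw [hx, mul_zero] at this
      exact_mod_cast this
    simp [roundCounts, h1]
  · have h1 := hQ.2 a.1 a.2 (lt_of_le_of_ne (hPX _) (Ne.symm hx)) h0
    have h2 : a.2 ≠ z₀ a.1 := by
      intro h2
      rw [h2] at h1
      exact (hz₀ a.1).ne' h1
    simp [roundCounts, h2, h1]

lemma exists_tendsto_channelOfCounts {PX : X → ℝ} (hPX : PX ∈ stdSimplex ℝ X)
    {P Q : X → Z → ℝ} (hP : P ∈ channels X Z) (hQ : Q ∈ dominated PX P) :
    ∃ J : ℕ → X × Z → ℕ,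
      (∀ n, (typeClass n PX).Nonempty →
        (∀ x, (fstCounts (J n) x : ℝ) = n * PX x) ∧ 0 < countsProb P (J n)) ∧
      Tendsto (fun n => channelOfCounts Q (J n))
        (atTop ⊓ 𝓟 {n | (typeClass n PX).Nonempty}) (𝓝 Q) := by
  classical
  have hz : ∀ x, ∃ z, 0 < Q x z := by
    intro x
    by_contra hc
    push Not at hc
    have := Finset.sum_nonpos fun z (_ : z ∈ Finset.univ) => hc z
    rw [(hQ.1 x).2] at this
    linarith
  choose z₀ hz₀ using hz
  have hk : ∀ n, ∃ k : X → ℕ, (typeClass n PX).Nonempty → ∀ x, (k x : ℝ) = n * PX x := by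
    intro n
    by_cases h : (typeClass n PX).Nonempty
    · obtain ⟨x, hx⟩ := h
      exact ⟨counts x, fun h =>
        counts_eq_of_mem_typeClass (pos_of_typeClass_nonempty hPX h) hx⟩
    · exact ⟨0, fun h' => absurd h' h⟩
  choose k hk using hk
  refine ⟨fun n => roundCounts (k n) z₀ Q, fun n hn => ⟨?_, ?_⟩, ?_⟩
  · rw [fstCounts_roundCounts hQ.1]; exact hk n hn
  · exact countsProb_roundCounts_pos hP hQ hz₀ (hk n hn) hPX.1
  rw [tendsto_pi_nhds]
  intro x
  rw [tendsto_pi_nhds]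
  intro z
  have hmem : ∀ᶠ n in atTop ⊓ 𝓟 {n | (typeClass n PX).Nonempty}, (typeClass n PX).Nonempty :=
    mem_inf_of_right (mem_principal_self _)
  -- A letter of weight zero does not occur, and its row in `channelOfCounts Q` is that of `Q`
  -- itself. Any other row is within `|Z| / (n PX x)` of `Q`.
  by_cases hx : PX x = 0
  · refine tendsto_const_nhds.congr' ?_
    filter_upwards [hmem] with n hn
    have h1 : k n x = 0 := by
      have := hk n hn x
      rw [hx, mul_zero] at this
      exact_mod_cast this
    simp [channelOfCounts, fstCounts_roundCounts hQ.1, h1]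
  · have hx' : 0 < PX x := lt_of_le_of_ne (hPX.1 x) (Ne.symm hx)
    rw [tendsto_iff_dist_tendsto_zero]
    have hlim : Tendsto (fun n : ℕ => (Fintype.card Z : ℝ) / PX x / n)
        (atTop ⊓ 𝓟 {n | (typeClass n PX).Nonempty}) (𝓝 0) :=
      (tendsto_const_div_atTop_nhds_zero_nat _).mono_left inf_le_left
    refine squeeze_zero' (Eventually.of_forall fun _ => dist_nonneg) ?_ hlim
    filter_upwards [hmem] with n hn
    have hn0 : (0 : ℝ) < n := by exact_mod_cast pos_of_typeClass_nonempty hPX hn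
    have hkx := hk n hn x
    have hkpos : (0 : ℝ) < k n x := by rw [hkx]; positivity
    have hkne : k n x ≠ 0 := by exact_mod_cast hkpos.ne'
    rw [Real.dist_eq, channelOfCounts, fstCounts_roundCounts hQ.1, if_neg hkne,
      div_sub' hkpos.ne', abs_div, abs_of_pos hkpos, div_div, mul_comm (PX x), ← hkx]
    gcongr
    exact abs_roundCounts_sub_le hQ.1 (k n) z₀ x z

/-! ### The limit -/

lemma tendsto_log_succ_div : Tendsto (fun n : ℕ => Real.log (n + 1) / n) atTop (𝓝 0) := by
  -- At the argument `n + 1` the denominator `1 * x + (-1)` is `n`.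
  have h1 := Real.tendsto_pow_log_div_mul_add_atTop 1 (-1) 1 one_ne_zero
  have h2 : Tendsto (fun n : ℕ => (n : ℝ) + 1) atTop atTop :=
    tendsto_atTop_add_const_right _ _ tendsto_natCast_atTop_atTop
  refine (h1.comp h2).congr fun n => ?_
  simp

lemma tendsto_typeError_div (X Z : Type*) [Fintype X] [Fintype Z] :
    Tendsto (fun n : ℕ => typeError X Z n / n) atTop (𝓝 0) := by
  have h := ((tendsto_const_div_atTop_nhds_zero_nat (1 : ℝ)).add tendsto_log_succ_div).const_mul
    ((Fintype.card X * Fintype.card Z + Fintype.card X + Fintype.card Z + 3 : ℝ))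
  rw [add_zero, mul_zero] at h
  refine h.congr fun n => ?_
  rw [typeError]
  ring

lemma tendsto_rateError {l : Filter ℕ} {R₁ R₂ : ℝ} {r₁ r₂ : ℕ → ℝ}
    (h₁ : Tendsto r₁ l (𝓝 (R₁ - R₂))) (h₂ : Tendsto r₂ l (𝓝 R₂)) :
    Tendsto (fun n => rateError R₁ R₂ (r₁ n) (r₂ n)) l (𝓝 0) := by
  have h := (((h₁.add h₂).sub_const R₁).abs).add ((h₁.sub_const (R₁ - R₂)).abs)
  simpa [rateError] using h

/-- The factor `log M + 2` of the upper bound is subexponential: it is at most `(n + 1) (r + 2)`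
with `r = log M / n`, and `log (r + 2) ≤ r + 1`. -/
lemma log_log_add_two_le {n M : ℕ} (hn : 0 < n) (hM : 0 < M) :
    Real.log (Real.log M + 2) ≤ Real.log (n + 1) + (Real.log M / n + 1) := by
  have hn' : (1 : ℝ) ≤ n := by exact_mod_cast hn
  have hlogM : 0 ≤ Real.log M := Real.log_nonneg (by exact_mod_cast hM)
  have h0 : 0 ≤ Real.log M / n := by positivity
  have h1 : Real.log M = n * (Real.log M / n) := by field_simp
  have h2 : Real.log M + 2 ≤ (n + 1) * (Real.log M / n + 2) := by
    nlinarith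
  refine (Real.log_le_log (by positivity) h2).trans ?_
  rw [Real.log_mul (by positivity) (by positivity)]
  linarith [Real.log_le_sub_one_of_pos (x := Real.log M / n + 2) (by positivity)]

/-- The upper bound on `P_c` uses that `Q` is minimal. The lower bound uses joint types whose
channels tend to `Q`, and continuity of the objective. -/
theorem tendsto_neg_log_avgCorrectProb {P : X → Z → ℝ} (hP : P ∈ channels X Z) {PX : X → ℝ}
    (hPX : PX ∈ stdSimplex ℝ X) {R₁ R₂ : ℝ} {M M₂ : ℕ → ℕ} (hM : ∀ n, 0 < M n)
    (hM₂ : ∀ n, 0 < M₂ n)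
    (hMlim : Tendsto (fun n : ℕ => Real.log (M n) / n)
      (atTop ⊓ 𝓟 {n | (typeClass n PX).Nonempty}) (𝓝 (R₁ - R₂)))
    (hM₂lim : Tendsto (fun n : ℕ => Real.log (M₂ n) / n)
      (atTop ⊓ 𝓟 {n | (typeClass n PX).Nonempty}) (𝓝 R₂))
    {dec : ∀ n, (Fin (M n) → Fin (M₂ n) → Fin n → X) → (Fin n → Z) → Fin (M n)}
    (hdec : ∀ n C, IsOptimalDecoder P C (dec n C)) {Q : X → Z → ℝ} (hQ : Q ∈ dominated PX P)
    (hmin : IsMinOn (rateObjective PX P R₁ (R₁ - R₂)) (dominated PX P) Q) :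
    Tendsto (fun n : ℕ => -Real.log (avgCorrectProb P PX (dec n)) / n)
      (atTop ⊓ 𝓟 {n | (typeClass n PX).Nonempty})
      (𝓝 (rateObjective PX P R₁ (R₁ - R₂) Q)) := by
  obtain ⟨J, hJ, hJlim⟩ := exists_tendsto_channelOfCounts hPX hP hQ
  have hrate := tendsto_rateError hMlim hM₂lim
  have hmem : ∀ᶠ n in atTop ⊓ 𝓟 {n | (typeClass n PX).Nonempty}, (typeClass n PX).Nonempty :=
    mem_inf_of_right (mem_principal_self _)
  have herr := (tendsto_typeError_div X Z).mono_left
    (inf_le_left (b := 𝓟 {n | (typeClass n PX).Nonempty}))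
  have hlog := tendsto_log_succ_div.mono_left
    (inf_le_left (b := 𝓟 {n | (typeClass n PX).Nonempty}))
  have hinv := (tendsto_const_div_atTop_nhds_zero_nat (1 : ℝ)).mono_left
    (inf_le_left (b := 𝓟 {n | (typeClass n PX).Nonempty}))
  have hobj := ((continuous_rateObjective PX P R₁ (R₁ - R₂)).tendsto Q).comp hJlim
  -- The power of `n + 1` from the number of joint types, and one more from the bound on `log (log M
  -- + 2)`.
  set c : ℝ := Fintype.card X * Fintype.card Z + 1 with hc
  have hlow : Tendsto (fun n : ℕ => rateObjective PX P R₁ (R₁ - R₂) Q -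
      (rateError R₁ R₂ (Real.log (M n) / n) (Real.log (M₂ n) / n) + typeError X Z n / n +
        c * (Real.log (n + 1) / n) + (Real.log (M n) / n + 1) * (1 / n)))
      (atTop ⊓ 𝓟 {n | (typeClass n PX).Nonempty})
      (𝓝 (rateObjective PX P R₁ (R₁ - R₂) Q)) := by
    have h := ((((hrate.add herr).add (hlog.const_mul c)).add
      ((hMlim.add_const 1).mul hinv))).const_sub (rateObjective PX P R₁ (R₁ - R₂) Q)
    simpa using h
  have hup : Tendsto (fun n : ℕ => rateObjective PX P R₁ (R₁ - R₂) (channelOfCounts Q (J n)) +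
      (rateError R₁ R₂ (Real.log (M n) / n) (Real.log (M₂ n) / n) + typeError X Z n / n +
        Real.log 2 * (1 / n)))
      (atTop ⊓ 𝓟 {n | (typeClass n PX).Nonempty})
      (𝓝 (rateObjective PX P R₁ (R₁ - R₂) Q)) := by
    have h := hobj.add ((hrate.add herr).add (hinv.const_mul (Real.log 2)))
    simpa using h
  refine tendsto_of_tendsto_of_tendsto_of_le_of_le' hlow hup ?_ ?_
  · filter_upwards [hmem] with n hT
    have hn := pos_of_typeClass_nonempty hPX hT
    have hn' : (0 : ℝ) < n := by exact_mod_cast hn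
    -- Monotonicity of the logarithm needs a positive argument, which the lower bound supplies.
    have hpos : 0 < avgCorrectProb P PX (dec n) := lt_of_lt_of_le (by positivity)
      (exp_le_avgCorrectProb hP hPX hT (hM n) (hM₂ n) R₁ R₂ (hdec n) Q (hJ n hT).1 (hJ n hT).2)
    have h1 := Real.log_le_log hpos
      (avgCorrectProb_le_exp hP hPX hT (hM n) (hM₂ n) hmin (dec n))
    have hlogM : 0 ≤ Real.log (M n) := Real.log_nonneg (by exact_mod_cast hM n)
    rw [Real.log_mul (by positivity) (by positivity), Real.log_mul (by positivity) (by positivity),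
      Real.log_exp, Real.log_pow] at h1
    have h2 := log_log_add_two_le hn (hM n)
    rw [le_div_iff₀ hn']
    set E := rateError R₁ R₂ (Real.log (M n) / n) (Real.log (M₂ n) / n)
    set m := Real.log (M n) / n
    have h3 : (rateObjective PX P R₁ (R₁ - R₂) Q - (E + typeError X Z n / n +
        c * (Real.log (n + 1) / n) + (m + 1) * (1 / n))) * n =
        n * (rateObjective PX P R₁ (R₁ - R₂) Q - E) - typeError X Z n -
          c * Real.log (n + 1) - (m + 1) := by
      field_simp
      ring
    rw [h3, hc]
    push_cast at h1
    linarith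
  · filter_upwards [hmem] with n hT
    have hn := pos_of_typeClass_nonempty hPX hT
    have hn' : (0 : ℝ) < n := by exact_mod_cast hn
    have h1 := Real.log_le_log (by positivity)
      (exp_le_avgCorrectProb hP hPX hT (hM n) (hM₂ n) R₁ R₂ (hdec n) Q (hJ n hT).1 (hJ n hT).2)
    rw [Real.log_mul (by positivity) (by positivity), Real.log_exp, one_div, Real.log_inv] at h1
    rw [div_le_iff₀ hn']
    set E := rateError R₁ R₂ (Real.log (M n) / n) (Real.log (M₂ n) / n)
    have h3 : (rateObjective PX P R₁ (R₁ - R₂) (channelOfCounts Q (J n)) +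
        (E + typeError X Z n / n + Real.log 2 * (1 / n))) * n =
        n * (rateObjective PX P R₁ (R₁ - R₂) (channelOfCounts Q (J n)) + E) +
          typeError X Z n + Real.log 2 := by
      field_simp
      ring
    rw [h3]
    linarith

end Wiretap

end

/-- The exact random-coding exponent of correct decoding at the wiretapper. The block length `n`
tends to infinity through the values at which the type class of `PX` is non-empty; `M n` is the
number of sub-codes (rate `R₁ - R₂`) and `M₂ n` the number of codewords of each (rate `R₂`). All
minima and maxima are attained (over a non-empty feasible set). -/
theorem theorem1 {X Z : Type*} [Fintype X] [Fintype Z]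
    (P : X → Z → ℝ) (hP : P ∈ Wiretap.channels X Z)
    (PX : X → ℝ) (hPX : PX ∈ stdSimplex ℝ X)
    (hType : ∃ n, (Wiretap.typeClass n PX).Nonempty)
    (R₁ R₂ : ℝ) (hR₂ : 0 ≤ R₂) (hR : R₂ ≤ R₁)
    (M M₂ : ℕ → ℕ) (hM : ∀ n, 0 < M n) (hM₂ : ∀ n, 0 < M₂ n)
    (hMlim : Tendsto (fun n : ℕ => Real.log (M n) / n)
      (atTop ⊓ 𝓟 {n | (Wiretap.typeClass n PX).Nonempty}) (𝓝 (R₁ - R₂)))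
    (hM₂lim : Tendsto (fun n : ℕ => Real.log (M₂ n) / n)
      (atTop ⊓ 𝓟 {n | (Wiretap.typeClass n PX).Nonempty}) (𝓝 R₂))
    (dec : ∀ n, (Fin (M n) → Fin (M₂ n) → Fin n → X) → (Fin n → Z) → Fin (M n))
    (hdec : ∀ n C, Wiretap.IsOptimalDecoder P C (dec n C)) :
    -- the exponent exists and equals `min {E₁, E₂, E₃}`
    Tendsto (fun n : ℕ =>
        ((-Real.log (Wiretap.avgCorrectProb P PX (dec n)) / n : ℝ) : EReal))
      (atTop ⊓ 𝓟 {n | (Wiretap.typeClass n PX).Nonempty})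
      (𝓝 (min (Wiretap.exponent₁ PX P R₁ R₂)
        (min (Wiretap.exponent₂ PX P R₁ R₂) (Wiretap.exponent₃ PX P R₁)))) ∧
    -- the alternative representation
    min (Wiretap.exponent₁ PX P R₁ R₂)
        (min (Wiretap.exponent₂ PX P R₁ R₂) (Wiretap.exponent₃ PX P R₁)) =
      (⨅ t₂ ∈ Icc (0 : ℝ) 1, ⨆ t₁ ∈ Icc (0 : ℝ) 1, ⨅ Q ∈ Wiretap.channels X Z,
        Wiretap.lagrangian PX P R₁ R₂ t₁ t₂ Q) ∧
    -- the minima in `E₁`, `E₂`, `E₃` are attained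
    ((Wiretap.feasible₁ X Z PX R₂).Nonempty →
      ∃ Q ∈ Wiretap.feasible₁ X Z PX R₂,
        IsMinOn (fun Q => Wiretap.condDiv PX Q P) (Wiretap.feasible₁ X Z PX R₂) Q) ∧
    ((Wiretap.feasible₂ X Z PX R₁ R₂).Nonempty →
      ∃ Q ∈ Wiretap.feasible₂ X Z PX R₁ R₂,
        IsMinOn (fun Q => Wiretap.condDiv PX Q P - (Wiretap.mutualInfo PX Q : EReal))
          (Wiretap.feasible₂ X Z PX R₁ R₂) Q) ∧
    ((Wiretap.feasible₃ X Z PX R₁).Nonempty →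
      ∃ Q ∈ Wiretap.feasible₃ X Z PX R₁,
        IsMinOn (fun Q => Wiretap.condDiv PX Q P) (Wiretap.feasible₃ X Z PX R₁) Q) ∧
    -- the minima and the maximum in the alternative representation are attained
    (∀ t₂ ∈ Icc (0 : ℝ) 1, ∀ t₁ ∈ Icc (0 : ℝ) 1, ∃ Q ∈ Wiretap.channels X Z,
      IsMinOn (Wiretap.lagrangian PX P R₁ R₂ t₁ t₂) (Wiretap.channels X Z) Q) ∧
    (∀ t₂ ∈ Icc (0 : ℝ) 1, ∃ t₁ ∈ Icc (0 : ℝ) 1,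
      IsMaxOn (fun t => Wiretap.innerMin PX P R₁ R₂ t t₂) (Icc (0 : ℝ) 1) t₁) ∧
    (∃ t₂ ∈ Icc (0 : ℝ) 1, IsMinOn (Wiretap.middleMax PX P R₁ R₂) (Icc (0 : ℝ) 1) t₂) := by
  have hPX0 := hPX.1
  obtain ⟨Q, hQ, hmin⟩ :=
    Wiretap.exists_isMinOn_rateObjective (PX := PX) hP R₁ (R₁ - R₂)
  have hE := Wiretap.min_exponent_eq hPX0 hR hQ hmin
  refine ⟨?_, ?_, ?_, ?_, ?_, ?_, ?_, ?_⟩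
  · rw [hE]
    exact (continuous_coe_real_ereal.tendsto _).comp
      (Wiretap.tendsto_neg_log_avgCorrectProb hP hPX hM hM₂ hMlim hM₂lim hdec hQ hmin)
  · rw [hE]
    exact (Wiretap.biInf_middleMax_eq hPX0 hP hR hQ hmin).symm
  · intro hne
    have h := Wiretap.exists_isMinOn_condDiv_sub hPX0 P (isClosed_Iic (a := R₂)) 0 hne
    simp only [zero_mul, EReal.coe_zero, sub_zero] at h
    exact h
  · intro hne
    have h := Wiretap.exists_isMinOn_condDiv_sub hPX0 P (isClosed_Icc (a := R₂) (b := R₁)) 1 hne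
    simp only [one_mul] at h
    exact h
  · intro hne
    have h := Wiretap.exists_isMinOn_condDiv_sub hPX0 P (isClosed_Ici (a := R₁)) 0 hne
    simp only [zero_mul, EReal.coe_zero, sub_zero] at h
    exact h
  · exact fun t₂ _ t₁ _ => Wiretap.exists_isMinOn_lagrangian hPX0 hP R₁ R₂ t₁ t₂
  · exact fun t₂ ht₂ => Wiretap.exists_isMaxOn_innerMin hPX0 hP R₁ R₂ ht₂
  · exact Wiretap.exists_isMinOn_middleMax hPX0 hP hR
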